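/- Let $H$ be a Lie group and $G\subset H$ a Lie subgroup (an injectively immersed, second countable Lie group), with Lie algebras $\mathfrak g\subset\mathfrak h$. Let $\pi:P\to M$ be a smooth principal $H$-bundle with right action $(p,a)\mapsto R_a p$ (all manifolds are finite-dimensional, smooth and without boundary). Let $Q\subset P$ be a principal $G$-subbundle: an (injectively immersed) submanifold which, with the restricted projection and the restriction of the $H$-action to $G$, is a smooth principal $G$-bundle over $M$. Write $\mathcal C(\cdot)$ for the set of connections on a principal bundle, identified with their connection $1$-forms: smooth $1$-forms on the total space with values in the Lie algebra of the structure group, of type $\mathrm{Ad}$ (that is, $R_a^*A=\mathrm{Ad}(a^{-1})\circ A$) and reproducing the generators of fundamental vector fields. Assume that there is a $G$-invariant splitting, i.e. a linear subspace $\mathfrak m\subset\mathfrak h$ with $\mathfrak h=\mathfrak g\oplus\mathfrak m$ and $\mathrm{Ad}(g)\mathfrak m\subset\mathfrak m$ for all $g\in G$, and let $\mathrm{pr}_{\mathfrak g}:\mathfrak h\to\mathfrak g$ be the projection along $\mathfrak m$. Let $h:M\to H$ be smooth with values in the normaliser $N_H(G)=\{a\in H: aGa^{-1}=G\}$, and let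 $Q'=\mathcal R_hQ$ be the image of $Q$, with the manifold structure transported from $Q$, under the map $\mathcal R_h:P\to P$, $p\mapsto R_{h(\pi(p))}p$. Then $Q'$ is a principal $G$-subbundle of $P$; every connection $A\in\mathcal C(Q)$ has a unique extension $\widehat f_Q(A)\in\mathcal C(P)$, meaning that the restriction of $\widehat f_Q(A)$ to $Q$ is $A$; for every $A\in\mathcal C(P)$ the form $\check f_{Q'}(A)=\mathrm{pr}_{\mathfrak g}\circ A|_{Q'}$ is a connection on $Q'$; and the map $$f_{Q,h}=\check f_{Q'}\circ\widehat f_Q:\ \mathcal C(Q)\to\mathcal C(Q')$$ is a bijection. -/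

import Mathlib

open scoped Manifold ContDiff

noncomputable section

/-- A smooth principal bundle with total space `P`, base `M` and structure group `H`: a smooth right
action of `H` on `P` together with a projection onto `M` which is locally, by equivariant
diffeomorphisms, the projection `U × H → U`. -/
structure PrincipalBundle
    (EM : Type*) [NormedAddCommGroup EM] [NormedSpace ℝ EM]
    (EH : Type*) [NormedAddCommGroup EH] [NormedSpace ℝ EH]
    (EP : Type*) [NormedAddCommGroup EP] [NormedSpace ℝ EP]
    (M : Type*) [TopologicalSpace M] [ChartedSpace EM M]
    (H : Type*) [TopologicalSpace H] [ChartedSpace EH H] [Group H]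
    (P : Type*) [TopologicalSpace P] [ChartedSpace EP P] where
  /-- the bundle projection -/
  proj : P → M
  /-- the right action of the structure group, `act p a = R_a p` -/
  act : P → H → P
  act_one : ∀ p, act p 1 = p
  act_mul : ∀ p a b, act p (a * b) = act (act p a) b
  contMDiff_act : ContMDiff (𝓘(ℝ, EP).prod 𝓘(ℝ, EH)) 𝓘(ℝ, EP) ∞ fun x : P × H => act x.1 x.2
  proj_act : ∀ p a, proj (act p a) = proj p
  locallyTrivial : ∀ x : M, ∃ e : Bundle.Trivialization H proj, x ∈ e.baseSet ∧
    ContMDiffOn 𝓘(ℝ, EP) (𝓘(ℝ, EM).prod 𝓘(ℝ, EH)) ∞ e e.source ∧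
    ContMDiffOn (𝓘(ℝ, EM).prod 𝓘(ℝ, EH)) 𝓘(ℝ, EP) ∞ e.toOpenPartialHomeomorph.symm e.target ∧
    ∀ p ∈ e.source, ∀ a : H, e (act p a) = ((e p).1, (e p).2 * a)

/-- The adjoint action of `a` on the Lie algebra: the differential at `1` of `g ↦ a g a⁻¹`. -/
def AdjointAction (EH : Type*) [NormedAddCommGroup EH] [NormedSpace ℝ EH]
    {H : Type*} [TopologicalSpace H] [ChartedSpace EH H] [Group H] (a : H) :
    GroupLieAlgebra 𝓘(ℝ, EH) H →L[ℝ] GroupLieAlgebra 𝓘(ℝ, EH) H :=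
  mfderiv 𝓘(ℝ, EH) 𝓘(ℝ, EH) (fun g : H => a * g * a⁻¹) 1

/-- A Lie subgroup of `H`, given as a Lie group `G` with an injective immersive homomorphism
into `H`. -/
structure LieSubgroupInclusion
    (EG : Type*) [NormedAddCommGroup EG] [NormedSpace ℝ EG]
    (EH : Type*) [NormedAddCommGroup EH] [NormedSpace ℝ EH]
    (G : Type*) [TopologicalSpace G] [ChartedSpace EG G] [Group G]
    (H : Type*) [TopologicalSpace H] [ChartedSpace EH H] [Group H] where
  toHom : G →* H
  contMDiff : ContMDiff 𝓘(ℝ, EG) 𝓘(ℝ, EH) ∞ toHom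
  injective : Function.Injective toHom
  immersive : ∀ g, Function.Injective (mfderiv 𝓘(ℝ, EG) 𝓘(ℝ, EH) toHom g)

/-- The inclusion of Lie algebras `𝔤 → 𝔥`. -/
def LieSubgroupInclusion.lie
    {EG : Type*} [NormedAddCommGroup EG] [NormedSpace ℝ EG]
    {EH : Type*} [NormedAddCommGroup EH] [NormedSpace ℝ EH]
    {G : Type*} [TopologicalSpace G] [ChartedSpace EG G] [Group G]
    {H : Type*} [TopologicalSpace H] [ChartedSpace EH H] [Group H]
    (ι : LieSubgroupInclusion EG EH G H) :
    GroupLieAlgebra 𝓘(ℝ, EG) G →L[ℝ] GroupLieAlgebra 𝓘(ℝ, EH) H :=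
  mfderiv 𝓘(ℝ, EG) 𝓘(ℝ, EH) ι.toHom 1

/-- `𝔥 = 𝔤 ⊕ 𝔪` as vector spaces, with `𝔪` stable under `Ad(g)` for all `g ∈ G`. -/
structure IsInvariantSplitting
    {EG : Type*} [NormedAddCommGroup EG] [NormedSpace ℝ EG]
    {EH : Type*} [NormedAddCommGroup EH] [NormedSpace ℝ EH]
    {G : Type*} [TopologicalSpace G] [ChartedSpace EG G] [Group G]
    {H : Type*} [TopologicalSpace H] [ChartedSpace EH H] [Group H]
    (ι : LieSubgroupInclusion EG EH G H)
    (𝔪 : Submodule ℝ (GroupLieAlgebra 𝓘(ℝ, EH) H)) : Prop where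
  isCompl : IsCompl (LinearMap.range ι.lie.toLinearMap) 𝔪
  invariant : ∀ g : G, ∀ X ∈ 𝔪, AdjointAction EH (ι.toHom g) X ∈ 𝔪

/-- The projection `𝔥 = 𝔤 ⊕ 𝔪 → 𝔤` along `𝔪`. -/
def IsInvariantSplitting.pr
    {EG : Type*} [NormedAddCommGroup EG] [NormedSpace ℝ EG]
    {EH : Type*} [NormedAddCommGroup EH] [NormedSpace ℝ EH]
    {G : Type*} [TopologicalSpace G] [ChartedSpace EG G] [Group G]
    {H : Type*} [TopologicalSpace H] [ChartedSpace EH H] [Group H]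
    {ι : LieSubgroupInclusion EG EH G H}
    {𝔪 : Submodule ℝ (GroupLieAlgebra 𝓘(ℝ, EH) H)} (hm : IsInvariantSplitting ι 𝔪) :
    GroupLieAlgebra 𝓘(ℝ, EH) H →ₗ[ℝ] GroupLieAlgebra 𝓘(ℝ, EG) G :=
  LinearMap.linearProjOfIsCompl 𝔪 ι.lie.toLinearMap (ι.immersive 1) hm.isCompl

/-- A principal `G`-subbundle of the principal `H`-bundle `B`: a principal `G`-bundle over the same
base whose total space `Q` is a submanifold of `P` (given as the image of the injective immersion
`incl`), whose projection is the restriction of the projection of `B`, and whose `G`-action is the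
restriction of the `H`-action. -/
structure PrincipalSubbundle
    {EM : Type*} [NormedAddCommGroup EM] [NormedSpace ℝ EM]
    {EG : Type*} [NormedAddCommGroup EG] [NormedSpace ℝ EG]
    {EH : Type*} [NormedAddCommGroup EH] [NormedSpace ℝ EH]
    {EP : Type*} [NormedAddCommGroup EP] [NormedSpace ℝ EP]
    {M : Type*} [TopologicalSpace M] [ChartedSpace EM M]
    {G : Type*} [TopologicalSpace G] [ChartedSpace EG G] [Group G]
    {H : Type*} [TopologicalSpace H] [ChartedSpace EH H] [Group H]
    {P : Type*} [TopologicalSpace P] [ChartedSpace EP P]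
    (B : PrincipalBundle EM EH EP M H P) (ι : LieSubgroupInclusion EG EH G H)
    (EQ : Type*) [NormedAddCommGroup EQ] [NormedSpace ℝ EQ]
    (Q : Type*) [TopologicalSpace Q] [ChartedSpace EQ Q] extends
    PrincipalBundle EM EG EQ M G Q where
  incl : Q → P
  contMDiff_incl : ContMDiff 𝓘(ℝ, EQ) 𝓘(ℝ, EP) ∞ incl
  injective_incl : Function.Injective incl
  immersive_incl : ∀ q, Function.Injective (mfderiv 𝓘(ℝ, EQ) 𝓘(ℝ, EP) incl q)
  proj_incl : ∀ q, B.proj (incl q) = proj q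
  incl_act : ∀ q g, incl (act q g) = B.act (incl q) (ι.toHom g)

namespace PrincipalBundle

variable {EM : Type*} [NormedAddCommGroup EM] [NormedSpace ℝ EM]
    {EH : Type*} [NormedAddCommGroup EH] [NormedSpace ℝ EH]
    {EP : Type*} [NormedAddCommGroup EP] [NormedSpace ℝ EP]
    {M : Type*} [TopologicalSpace M] [ChartedSpace EM M]
    {H : Type*} [TopologicalSpace H] [ChartedSpace EH H] [Group H]
    {P : Type*} [TopologicalSpace P] [ChartedSpace EP P]

/-- The map `p ↦ R_{h(π(p))} p` of the total space induced by `h : M → H`. -/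
def deform (B : PrincipalBundle EM EH EP M H P) (h : M → H) (p : P) : P :=
  B.act p (h (B.proj p))

/-- A connection on a principal bundle, given by its connection form: a smooth 1-form on the total
space with values in the Lie algebra of the structure group, with `R_a^* A = Ad(a⁻¹) ∘ A`, which
maps the fundamental vector field of each Lie algebra element `X` to `X`. -/
@[ext]
structure Connection [IsManifold 𝓘(ℝ, EP) ∞ P] (B : PrincipalBundle EM EH EP M H P) where
  form : ∀ p : P, TangentSpace 𝓘(ℝ, EP) p →L[ℝ] GroupLieAlgebra 𝓘(ℝ, EH) H
  /-- smoothness, as a map from the tangent bundle of `P` to the vector space `𝔥` -/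
  smooth : ContMDiff 𝓘(ℝ, EP).tangent 𝓘(ℝ, EH) ∞
    fun v : TangentBundle 𝓘(ℝ, EP) P => (show EH from form v.proj v.snd)
  equivariant : ∀ (a : H) (p : P) (v : TangentSpace 𝓘(ℝ, EP) p),
    form (B.act p a) (mfderiv 𝓘(ℝ, EP) 𝓘(ℝ, EP) (fun p' => B.act p' a) p v) =
      AdjointAction EH a⁻¹ (form p v)
  /-- note that `B.act p 1 = p` -/
  fundamental : ∀ (p : P) (X : GroupLieAlgebra 𝓘(ℝ, EH) H),
    form (B.act p 1) (mfderiv 𝓘(ℝ, EH) 𝓘(ℝ, EP) (fun a => B.act p a) 1 X) = X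

end PrincipalBundle

namespace PrincipalSubbundle

variable {EM : Type*} [NormedAddCommGroup EM] [NormedSpace ℝ EM]
    {EG : Type*} [NormedAddCommGroup EG] [NormedSpace ℝ EG]
    {EH : Type*} [NormedAddCommGroup EH] [NormedSpace ℝ EH]
    {EP : Type*} [NormedAddCommGroup EP] [NormedSpace ℝ EP]
    {M : Type*} [TopologicalSpace M] [ChartedSpace EM M]
    {G : Type*} [TopologicalSpace G] [ChartedSpace EG G] [Group G]
    {H : Type*} [TopologicalSpace H] [ChartedSpace EH H] [Group H]
    {P : Type*} [TopologicalSpace P] [ChartedSpace EP P] [IsManifold 𝓘(ℝ, EP) ∞ P]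
    {B : PrincipalBundle EM EH EP M H P} {ι : LieSubgroupInclusion EG EH G H}
    {EQ : Type*} [NormedAddCommGroup EQ] [NormedSpace ℝ EQ]
    {Q : Type*} [TopologicalSpace Q] [ChartedSpace EQ Q] [IsManifold 𝓘(ℝ, EQ) ∞ Q]

/-- The space `C(Q)` of connections on the principal `G`-bundle `Q`. -/
abbrev Connection (S : PrincipalSubbundle B ι EQ Q) : Type _ :=
  S.toPrincipalBundle.Connection

/-- The restriction `A|_Q` of the `𝔥`-valued 1-form `A` to the submanifold `Q`. -/
def restrictForm (S : PrincipalSubbundle B ι EQ Q) (A : B.Connection) (q : Q) :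
    TangentSpace 𝓘(ℝ, EQ) q →L[ℝ] GroupLieAlgebra 𝓘(ℝ, EH) H :=
  (A.form (S.incl q)).comp (mfderiv 𝓘(ℝ, EQ) 𝓘(ℝ, EP) S.incl q)

/-- The connection `A'` on the ambient bundle extends the connection `A` on `Q`: `A'|_Q = A`, where
`𝔤` is regarded as a subspace of `𝔥`. -/
def IsExtension (S : PrincipalSubbundle B ι EQ Q) (A : S.Connection) (A' : B.Connection) : Prop :=
  ∀ q, S.restrictForm A' q = ι.lie.comp (A.form q)

end PrincipalSubbundle

end

/-! Everything rests on one formula (`IsConnectionOver.apply_act`): a connection form evaluated on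
the velocity of a family q(n)a(n) is Ad(a⁻¹) of its value on the velocity of q, plus a⁻¹ȧ.

Extension. Over an open set with a section σ of Q, each point of P is p = σ(π(p)) α(p), so the
formula determines an extension of A at p from A along σ (`eq_extForm`). Conversely, the resulting
expression is a connection form extending A over that set. By uniqueness the local expressions agree
on overlaps, so they glue to a global connection (`extend`).

Bijectivity. Q' is modelled on the manifold Q itself, with inclusion q ↦ R_h q. By the same formula
f_{Q,h}(A) is then pr(Ad(h⁻¹)A) + pr(h⁻¹dh), where h stands for h ∘ π. The normaliser preserves 𝔤,
so pr acts as the identity on Ad(h⁻¹)A: the map is affine with injective linear part. For a preimage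
of A', extend A' to P, restrict to Q and project to 𝔤 along Ad(h)𝔪, which is again a G-invariant
complement because h normalises G.

Q' as a bundle. Its action is q·g = q(hgh⁻¹), so (x, g) ↦ h(x)gh(x)⁻¹ must be smooth as a map into
G, not just into H. As G is only immersed, this needs second countability: such a subgroup is weakly
embedded (`contMDiff_of_comp`). -/

noncomputable section

set_option linter.unusedSectionVars false

open scoped Topology
open Bundle

/-! ### Differentials as linear maps between fixed model spaces, free of dependent tangent space
types. -/

section Differential

variable {E E' E'' F F' : Type*}
  [NormedAddCommGroup E] [NormedSpace ℝ E] [NormedAddCommGroup E'] [NormedSpace ℝ E']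
  [NormedAddCommGroup E''] [NormedSpace ℝ E''] [NormedAddCommGroup F] [NormedSpace ℝ F]
  [NormedAddCommGroup F'] [NormedSpace ℝ F']
  {K K' K'' : Type*} [TopologicalSpace K] [TopologicalSpace K'] [TopologicalSpace K'']
  {M M' M'' : Type*}
  [TopologicalSpace M] [ChartedSpace K M] [TopologicalSpace M'] [ChartedSpace K' M']
  [TopologicalSpace M''] [ChartedSpace K'' M'']
  {I : ModelWithCorners ℝ E K} {I' : ModelWithCorners ℝ E' K'} {I'' : ModelWithCorners ℝ E'' K''}

variable (I I') in
/-- The differential of a map between manifolds, as a linear map between the model spaces. -/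
def tderiv (f : M → M') (x : M) : E →L[ℝ] E' := mfderiv I I' f x

theorem tderiv_comp {g : M' → M''} {f : M → M'} {x : M} {y : M'}
    (hg : MDifferentiableAt I' I'' g y) (hf : MDifferentiableAt I I' f x) (hy : f x = y) (v : E) :
    tderiv I I'' (fun x => g (f x)) x v = tderiv I' I'' g y (tderiv I I' f x v) :=
  mfderiv_comp_apply_of_eq x hg hf hy v

theorem tderiv_const (c : M') (x : M) (v : E) : tderiv I I' (fun _ : M => c) x v = 0 :=
  DFunLike.congr_fun (mfderiv_const (I := I) (I' := I') (x := x) (c := c)) v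

theorem tderiv_id (x : M) (v : E) : tderiv I I (fun x : M => x) x v = v :=
  DFunLike.congr_fun (mfderiv_id (I := I) (x := x)) v

theorem tderiv_congr {f g : M → M'} {x : M} (h : f =ᶠ[𝓝 x] g) :
    tderiv I I' f x = tderiv I I' g x :=
  h.mfderiv_eq

theorem tderiv_prodMk {f : M → M'} {g : M → M''} {x : M} (hf : MDifferentiableAt I I' f x)
    (hg : MDifferentiableAt I I'' g x) (v : E) :
    tderiv I (I'.prod I'') (fun x => (f x, g x)) x v = (tderiv I I' f x v, tderiv I I'' g x v) :=
  DFunLike.congr_fun (mfderiv_prodMk hf hg) v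

variable {L : Type*} [TopologicalSpace L] {N : Type*} [TopologicalSpace N] [ChartedSpace L N]
  {J : ModelWithCorners ℝ F L}

/-- The product rule in the form needed for group multiplication and for the bundle action. -/
theorem tderiv_comp₂ {f : M × M' → M''} {a : N → M} {b : N → M'} {n : N}
    (hf : MDifferentiableAt (I.prod I') I'' f (a n, b n)) (ha : MDifferentiableAt J I a n)
    (hb : MDifferentiableAt J I' b n) (v : F) :
    tderiv J I'' (fun n => f (a n, b n)) n v =
      tderiv I I'' (fun x => f (x, b n)) (a n) (tderiv J I a n v) +
      tderiv I' I'' (fun y => f (a n, y)) (b n) (tderiv J I' b n v) := by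
  rw [tderiv_comp (f := fun n => (a n, b n)) hf (ha.prodMk hb) rfl, tderiv_prodMk ha hb]
  exact mfderiv_prod_eq_add_apply (v := (tderiv J I a n v, tderiv J I' b n v)) hf

end Differential

/-! ### Smoothness of tangent maps and of their vector parts. -/

section Smoothness

variable {E E' F : Type*}
  [NormedAddCommGroup E] [NormedSpace ℝ E] [NormedAddCommGroup E'] [NormedSpace ℝ E']
  [NormedAddCommGroup F] [NormedSpace ℝ F]
  {K K' L : Type*} [TopologicalSpace K] [TopologicalSpace K'] [TopologicalSpace L]
  {M M' N : Type*}
  [TopologicalSpace M] [ChartedSpace K M] [TopologicalSpace M'] [ChartedSpace K' M']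
  [TopologicalSpace N] [ChartedSpace L N]
  {I : ModelWithCorners ℝ E K} {I' : ModelWithCorners ℝ E' K'} {J : ModelWithCorners ℝ F L}

theorem trivializationAt_snd_of_proj_eq [IsManifold I 1 M] (z : TangentBundle I M) {x : M}
    (hx : z.proj = x) :
    (trivializationAt E (TangentSpace I : M → Type _) x z).2 = (show E from z.snd) := by
  subst hx
  rw [TangentBundle.trivializationAt_apply]
  exact tangentCoordChange_self (I := I) (x := z.proj) (z := z.proj) (v := (show E from z.snd))
    (mem_extChartAt_source z.proj)

/-- The vector part of a smooth map into a fixed fibre of the tangent bundle is smooth. -/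
theorem contMDiffAt_snd_of_proj_eq [IsManifold I 1 M] {f : N → TangentBundle I M} {c : M}
    (hc : ∀ n, (f n).proj = c) {n : N} {k : WithTop ℕ∞} (hf : ContMDiffAt J I.tangent k f n) :
    ContMDiffAt J 𝓘(ℝ, E) k (fun n => (show E from (f n).snd)) n :=
  (contMDiffAt_totalSpace.1 hf).2.congr_of_eventuallyEq <| Filter.Eventually.of_forall fun m =>
    (trivializationAt_snd_of_proj_eq (f m) ((hc m).trans (hc n).symm)).symm

/-- On an open set the tangent map within the set is the full tangent map. This serves group
coordinates and sections that exist only locally. -/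
theorem ContMDiffOn.contMDiffAt_tangentMap [IsManifold I 1 M] [IsManifold I' 1 M']
    {f : M → M'} {s : Set M} (hf : ContMDiffOn I I' ∞ f s) (hs : IsOpen s)
    {v : TangentBundle I M} (hv : v.proj ∈ s) :
    ContMDiffAt I.tangent I'.tangent ∞ (tangentMap I I' f) v := by
  have h := hf.contMDiffOn_tangentMapWithin (m := ∞) le_rfl hs.uniqueMDiffOn
  have hopen : π E (TangentSpace I : M → Type _) ⁻¹' s ∈ 𝓝 v :=
    (hs.preimage (FiberBundle.continuous_proj E (TangentSpace I : M → Type _))).mem_nhds hv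
  refine (h.contMDiffAt hopen).congr_of_eventuallyEq ?_
  filter_upwards [hopen] with w hw
  refine (tangentMapWithin_eq_tangentMap (hs.uniqueMDiffOn _ hw) ?_).symm
  exact (hf.contMDiffAt (hs.mem_nhds hw)).mdifferentiableAt (by simp)

end Smoothness

/-! ### Recentred charts and the inverse function theorem. -/

section ChartParam

variable {E : Type*} [NormedAddCommGroup E] [NormedSpace ℝ E]
  {M : Type*} [TopologicalSpace M] [ChartedSpace E M]

/-- The inverse of the preferred chart at `x`, recentred such that `0` is mapped to `x`. -/
def chartParam (x : M) (v : E) : M :=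
  (extChartAt 𝓘(ℝ, E) x).symm (extChartAt 𝓘(ℝ, E) x x + v)

theorem chartParam_zero (x : M) : chartParam x (0 : E) = x := by
  simp [chartParam]

theorem contMDiffAt_chartParam [IsManifold 𝓘(ℝ, E) ∞ M] (x : M) :
    ContMDiffAt 𝓘(ℝ, E) 𝓘(ℝ, E) ∞ (chartParam x : E → M) 0 := by
  have h : ContMDiffAt 𝓘(ℝ, E) 𝓘(ℝ, E) ∞ (extChartAt 𝓘(ℝ, E) x).symm
      (extChartAt 𝓘(ℝ, E) x x) :=
    (contMDiffOn_extChartAt_symm x).contMDiffAt (extChartAt_target_mem_nhds x)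
  refine ContMDiffAt.comp_of_eq (g := (extChartAt 𝓘(ℝ, E) x).symm)
    (f := fun v => extChartAt 𝓘(ℝ, E) x x + v) h ?_ (add_zero _)
  exact (contDiff_const.add contDiff_id).contMDiff.contMDiffAt

/-- The tangent space at `x` is identified with the model space through this same preferred chart,
so its differential at `x` is the identity. -/
theorem tderiv_chartParam [IsManifold 𝓘(ℝ, E) ∞ M] (x : M) (v : E) :
    tderiv 𝓘(ℝ, E) 𝓘(ℝ, E) (chartParam x : E → M) 0 v = v := by
  have : IsManifold 𝓘(ℝ, E) 1 M := .of_le (n := ∞) (by simp)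
  have h : MDifferentiableAt 𝓘(ℝ, E) 𝓘(ℝ, E) (extChartAt 𝓘(ℝ, E) x).symm
      (extChartAt 𝓘(ℝ, E) x x) :=
    ((contMDiffOn_extChartAt_symm (n := ∞) x).contMDiffAt
      (extChartAt_target_mem_nhds x)).mdifferentiableAt (by simp)
  have h' : HasFDerivAt (fun v : E => extChartAt 𝓘(ℝ, E) x x + v) (.id ℝ E) 0 :=
    (hasFDerivAt_id _).const_add _
  have e := tderiv_comp (x := (0 : E)) (f := fun v => extChartAt 𝓘(ℝ, E) x x + v) h
    h'.differentiableAt.mdifferentiableAt (add_zero _) v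
  have e1 : tderiv 𝓘(ℝ, E) 𝓘(ℝ, E) (fun v : E => extChartAt 𝓘(ℝ, E) x x + v) 0 v = v :=
    (DFunLike.congr_fun (mfderiv_eq_fderiv.trans h'.fderiv) v :)
  have e2 : tderiv 𝓘(ℝ, E) 𝓘(ℝ, E) (extChartAt 𝓘(ℝ, E) x).symm (extChartAt 𝓘(ℝ, E) x x) v = v := by
    have := mfderivWithin_range_extChartAt_symm (I := 𝓘(ℝ, E)) (x := x)
    rw [modelWithCornersSelf_coe, Set.range_id, mfderivWithin_univ] at this
    exact DFunLike.congr_fun this v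
  rw [e1, e2] at e
  exact e

theorem image_chartParam_mem_nhds (x : M) {s : Set E} (hs : s ∈ 𝓝 0) :
    chartParam x '' s ∈ 𝓝 x := by
  have h1 : ContinuousAt (fun y => extChartAt 𝓘(ℝ, E) x y - extChartAt 𝓘(ℝ, E) x x) x :=
    (continuousAt_extChartAt x).sub continuousAt_const
  have h2 := h1.preimage_mem_nhds (t := s) (by simpa using hs)
  filter_upwards [h2, extChartAt_source_mem_nhds (I := 𝓘(ℝ, E)) x] with y hy hy'
  refine ⟨_, hy, ?_⟩
  rw [chartParam, add_sub_cancel]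
  exact (extChartAt 𝓘(ℝ, E) x).left_inv hy'

end ChartParam

section

variable {E E' : Type*} [NormedAddCommGroup E] [NormedSpace ℝ E] [FiniteDimensional ℝ E]
  [NormedAddCommGroup E'] [NormedSpace ℝ E']
  {H : Type*} [TopologicalSpace H] [ChartedSpace E' H] [IsManifold 𝓘(ℝ, E') ∞ H]

/-- The inverse function theorem for a map from a vector space to a manifold. -/
theorem exists_local_inverse [FiniteDimensional ℝ E'] {Ψ : E → H} {x : H} (hx : Ψ 0 = x)
    (hΨ : ContMDiffAt 𝓘(ℝ, E) 𝓘(ℝ, E') ∞ Ψ 0)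
    (hbij : Function.Bijective (tderiv 𝓘(ℝ, E) 𝓘(ℝ, E') Ψ 0)) :
    ∃ (s : Set E) (t : Set H) (z : H → E), s ∈ 𝓝 0 ∧ t ∈ 𝓝 x ∧ Set.InjOn Ψ s ∧ z x = 0 ∧
      ContMDiffAt 𝓘(ℝ, E') 𝓘(ℝ, E) ∞ z x ∧ ContinuousOn z t ∧ ∀ y ∈ t, Ψ (z y) = y := by
  subst hx
  set φ := extChartAt 𝓘(ℝ, E') (Ψ 0)
  have hφ : ContMDiffAt 𝓘(ℝ, E') 𝓘(ℝ, E') ∞ φ (Ψ 0) := contMDiffAt_extChartAt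
  have hΦ : ContDiffAt ℝ ∞ (fun v => φ (Ψ v)) 0 :=
    contMDiffAt_iff_contDiffAt.1 (hφ.comp 0 hΨ)
  have : IsManifold 𝓘(ℝ, E') 1 H := .of_le (n := ∞) (by simp)
  have hD : ∀ v, fderiv ℝ (fun v => φ (Ψ v)) 0 v = tderiv 𝓘(ℝ, E) 𝓘(ℝ, E') Ψ 0 v := by
    intro v
    have e := tderiv_comp (hφ.mdifferentiableAt (by simp)) (hΨ.mdifferentiableAt (by simp)) rfl v
    have e2 : ∀ w : E', tderiv 𝓘(ℝ, E') 𝓘(ℝ, E') φ (Ψ 0) w = w := fun w =>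
      DFunLike.congr_fun (mfderiv_extChartAt_self (I := 𝓘(ℝ, E')) (x := Ψ 0)) w
    rw [e2] at e
    rw [← e, tderiv, mfderiv_eq_fderiv]
  let D : E ≃L[ℝ] E' :=
    (LinearEquiv.ofBijective (tderiv 𝓘(ℝ, E) 𝓘(ℝ, E') Ψ 0).toLinearMap hbij).toContinuousLinearEquiv
  have hD' : HasFDerivAt (fun v => φ (Ψ v)) (D : E →L[ℝ] E') 0 := by
    have h := (hΦ.differentiableAt (by simp)).hasFDerivAt
    have e : fderiv ℝ (fun v => φ (Ψ v)) 0 = (D : E →L[ℝ] E') := ContinuousLinearMap.ext hD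
    rwa [e] at h
  have : CompleteSpace E := FiniteDimensional.complete ℝ E
  let T := hΦ.toOpenPartialHomeomorph _ hD' (by simp)
  have hT : ∀ v, T v = φ (Ψ v) := fun v => rfl
  have h0 : (0 : E) ∈ T.source := hΦ.mem_toOpenPartialHomeomorph_source hD' (by simp)
  have hT0 : T.symm (φ (Ψ 0)) = 0 := T.left_inv h0
  have h0' : φ (Ψ 0) ∈ T.target := T.map_source h0
  have hsymm : ContDiffAt ℝ ∞ T.symm (φ (Ψ 0)) :=
    T.contDiffAt_symm h0' (f₀' := D) (by rw [hT0]; exact hD') (by rw [hT0]; exact hΦ)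
  have hcont : ContinuousAt (fun y => T.symm (φ y)) (Ψ 0) :=
    ContinuousAt.comp (f := φ) hsymm.continuousAt hφ.continuousAt
  have hsrc : φ.source ∈ 𝓝 (Ψ 0) := extChartAt_source_mem_nhds _
  -- The last condition on `y` is there because φ is injective only on its source: it lets φ(Ψ(z y))
  -- = φ(y) be cancelled.
  refine ⟨T.source, {y | y ∈ φ.source ∧ φ y ∈ T.target ∧ Ψ (T.symm (φ y)) ∈ φ.source},
    fun y => T.symm (φ y), T.open_source.mem_nhds h0, ?_, ?_, hT0, ?_, ?_, ?_⟩
  · refine Filter.inter_mem hsrc (Filter.inter_mem ?_ ?_)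
    · exact hφ.continuousAt.preimage_mem_nhds (T.open_target.mem_nhds h0')
    · have : ContinuousAt (fun y => Ψ (T.symm (φ y))) (Ψ 0) := by
        refine ContinuousAt.comp (f := fun y => T.symm (φ y)) ?_ hcont
        rw [hT0]
        exact hΨ.continuousAt
      exact this.preimage_mem_nhds (by rw [hT0]; exact hsrc)
  · intro v hv w hw h
    exact T.injOn hv hw (by rw [hT, hT, h])
  · exact hsymm.contMDiffAt.comp (Ψ 0) hφ
  · refine ContinuousOn.comp (t := T.target) T.continuousOn_symm ?_ fun y hy => hy.2.1
    exact (continuousOn_extChartAt (Ψ 0)).mono fun y hy => hy.1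
  · intro y hy
    exact φ.injOn hy.2.2 hy.1 (T.right_inv hy.2.1)

end

/-! ### Second countable Lie subgroups are weakly embedded. -/

section WeakEmbedding

variable {EG : Type*} [NormedAddCommGroup EG] [NormedSpace ℝ EG] [FiniteDimensional ℝ EG]
  {EH : Type*} [NormedAddCommGroup EH] [NormedSpace ℝ EH] [FiniteDimensional ℝ EH]
  {G : Type*} [TopologicalSpace G] [ChartedSpace EG G] [Group G] [LieGroup 𝓘(ℝ, EG) ∞ G]
  {H : Type*} [TopologicalSpace H] [ChartedSpace EH H] [Group H] [LieGroup 𝓘(ℝ, EH) ∞ H]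
  {F L N : Type*} [NormedAddCommGroup F] [NormedSpace ℝ F] [TopologicalSpace L]
  [TopologicalSpace N] [ChartedSpace L N] {J : ModelWithCorners ℝ F L}

namespace LieSubgroupInclusion

/-- The map `(X, v) ↦ s(X) ι(u(v))`, whose slices `X = const` are pieces of cosets of `G`. -/
def slice (ι : LieSubgroupInclusion EG EH G H) (C : Submodule ℝ EH) (x : C × EG) : H :=
  chartParam (1 : H) (x.1 : EH) * ι.toHom (chartParam (1 : G) x.2)

variable (ι : LieSubgroupInclusion EG EH G H) (C : Submodule ℝ EH)

theorem slice_zero : ι.slice C 0 = 1 := by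
  simp [slice, chartParam_zero]

theorem contMDiffAt_slice_left :
    ContMDiffAt 𝓘(ℝ, C × EG) 𝓘(ℝ, EH) ∞ (fun x : C × EG => chartParam (1 : H) (x.1 : EH)) 0 :=
  ContMDiffAt.comp_of_eq (f := fun x : C × EG => (x.1 : EH)) (contMDiffAt_chartParam (1 : H))
    (C.subtypeL.contDiff.comp contDiff_fst).contMDiff.contMDiffAt (by simp)

theorem contMDiffAt_slice_right :
    ContMDiffAt 𝓘(ℝ, C × EG) 𝓘(ℝ, EH) ∞
      (fun x : C × EG => ι.toHom (chartParam (1 : G) x.2)) 0 :=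
  ContMDiffAt.comp_of_eq (f := fun x : C × EG => chartParam (1 : G) x.2) ι.contMDiff.contMDiffAt
    (ContMDiffAt.comp_of_eq (f := fun x : C × EG => x.2) (contMDiffAt_chartParam (1 : G))
    contDiff_snd.contMDiff.contMDiffAt (by simp)) rfl

theorem contMDiffAt_slice : ContMDiffAt 𝓘(ℝ, C × EG) 𝓘(ℝ, EH) ∞ (ι.slice C) 0 :=
  (contMDiffAt_slice_left C).mul (ι.contMDiffAt_slice_right C)

/-- Product rule at (1, 1), where both partial multiplications are the identity map. -/
theorem tderiv_slice (x : C × EG) :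
    tderiv 𝓘(ℝ, C × EG) 𝓘(ℝ, EH) (ι.slice C) 0 x =
      x.1 + tderiv 𝓘(ℝ, EG) 𝓘(ℝ, EH) ι.toHom 1 x.2 := by
  have hmul : ContMDiff (𝓘(ℝ, EH).prod 𝓘(ℝ, EH)) 𝓘(ℝ, EH) ∞ (fun p : H × H => p.1 * p.2) :=
    contMDiff_mul _ _
  have h1 : MDifferentiableAt 𝓘(ℝ, C × EG) 𝓘(ℝ, EH) (fun x : C × EG => (x.1 : EH)) 0 :=
    (C.subtypeL.contDiff.comp contDiff_fst).contMDiff.contMDiffAt.mdifferentiableAt (n := ∞)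
      (by simp)
  have h2 : MDifferentiableAt 𝓘(ℝ, C × EG) 𝓘(ℝ, EG) (fun x : C × EG => x.2) 0 :=
    contDiff_snd.contMDiff.contMDiffAt.mdifferentiableAt (n := ∞) (by simp)
  have d1 : tderiv 𝓘(ℝ, C × EG) 𝓘(ℝ, EH) (fun x : C × EG => (x.1 : EH)) 0 x = x.1 :=
    (DFunLike.congr_fun (mfderiv_eq_fderiv.trans
      (C.subtypeL.comp (ContinuousLinearMap.fst ℝ C EG)).fderiv) x :)
  have d2 : tderiv 𝓘(ℝ, C × EG) 𝓘(ℝ, EG) (fun x : C × EG => x.2) 0 x = x.2 :=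
    (DFunLike.congr_fun (mfderiv_eq_fderiv.trans
      (ContinuousLinearMap.snd ℝ C EG).fderiv) x :)
  have hs := ((contMDiffAt_chartParam (E := EH) (1 : H)).mdifferentiableAt (by simp))
  have hu := ((contMDiffAt_chartParam (E := EG) (1 : G)).mdifferentiableAt (by simp))
  have hι : MDifferentiableAt 𝓘(ℝ, EG) 𝓘(ℝ, EH) ι.toHom 1 :=
    ι.contMDiff.contMDiffAt.mdifferentiableAt (by simp)
  have e := tderiv_comp₂ (J := 𝓘(ℝ, C × EG)) (n := (0 : C × EG)) (f := fun p : H × H => p.1 * p.2)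
    (a := fun x : C × EG => chartParam (1 : H) (x.1 : EH))
    (b := fun x : C × EG => ι.toHom (chartParam (1 : G) x.2))
    (hmul.contMDiffAt.mdifferentiableAt (by simp))
    ((contMDiffAt_slice_left C).mdifferentiableAt (by simp))
    ((ι.contMDiffAt_slice_right C).mdifferentiableAt (by simp)) x
  have ea : chartParam (1 : H) (((0 : C × EG).1 : C) : EH) = 1 := chartParam_zero 1
  have eb : ι.toHom (chartParam (1 : G) (0 : C × EG).2) = 1 := by
    rw [Prod.snd_zero, chartParam_zero, map_one]
  rw [ea, eb] at e
  simp only [mul_one, one_mul, tderiv_id] at e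
  rw [tderiv_comp hs h1 (by simp), d1, tderiv_chartParam,
    tderiv_comp (f := fun x : C × EG => chartParam (1 : G) x.2) (y := 1) hι
      (MDifferentiableAt.comp_of_eq (f := fun x : C × EG => x.2) (x := (0 : C × EG)) hu h2
        (by simp))
      (chartParam_zero 1),
    tderiv_comp hu h2 (by simp), d2, tderiv_chartParam] at e
  exact e

/-- The differential is (X, v) ↦ X + Dι(v) with Dι injective, so bijectivity says exactly that `C`
complements the image of Dι. Hence the slices foliate a neighbourhood of 1. -/
theorem bijective_tderiv_slice {C : Submodule ℝ EH}
    (hC : IsCompl (LinearMap.range (tderiv 𝓘(ℝ, EG) 𝓘(ℝ, EH) ι.toHom 1).toLinearMap) C) :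
    Function.Bijective (tderiv 𝓘(ℝ, C × EG) 𝓘(ℝ, EH) (ι.slice C) 0) := by
  set D := tderiv 𝓘(ℝ, EG) 𝓘(ℝ, EH) ι.toHom 1
  have hinj : Function.Injective D := ι.immersive 1
  constructor
  · rw [injective_iff_map_eq_zero]
    intro x hx
    rw [tderiv_slice] at hx
    have h1 : (x.1 : EH) ∈ LinearMap.range D.toLinearMap := by
      refine ⟨-x.2, ?_⟩
      have : D (-x.2) = x.1 := by rw [map_neg]; exact (eq_neg_of_add_eq_zero_left hx).symm
      exact this
    have h2 : (x.1 : EH) = 0 := Submodule.disjoint_def.1 hC.disjoint _ h1 x.1.2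
    rw [h2, zero_add] at hx
    exact Prod.ext (Subtype.ext h2) (hinj (hx.trans (map_zero D).symm))
  · intro y
    obtain ⟨_, ⟨v, rfl⟩, c, hc, h⟩ := Submodule.mem_sup.1
      (hC.sup_eq_top ▸ Submodule.mem_top : y ∈ LinearMap.range D.toLinearMap ⊔ C)
    refine ⟨(⟨c, hc⟩, v), ?_⟩
    rw [tderiv_slice, add_comm]
    exact h

/-- The slices in which a neighbourhood of `1` meets a second countable Lie subgroup are
countably many. -/
theorem countable_slices [SecondCountableTopology G] {s : Set (C × EG)} {a : Set C} {b : Set EG}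
    (hb : b ∈ 𝓝 0) (hab : a ×ˢ b ⊆ s) (hinj : Set.InjOn (ι.slice C) s) :
    {X ∈ a | chartParam (1 : H) (X : EH) ∈ ι.toHom.range}.Countable := by
  have hX : ∀ X : {X ∈ a | chartParam (1 : H) (X : EH) ∈ ι.toHom.range},
      ∃ g : G, ι.toHom g = chartParam (1 : H) ((X : C) : EH) := fun X => X.2.2
  choose g hg using hX
  let V : Set G := interior (chartParam (1 : G) '' b)
  have hV : (1 : G) ∈ V := mem_interior_iff_mem_nhds.2 (image_chartParam_mem_nhds 1 hb)
  have : IsTopologicalGroup G := topologicalGroup_of_lieGroup 𝓘(ℝ, EG) ∞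
  -- These sets are the translates of V by the elements `g X`. A common point of two of them would
  -- have two preimages under the injective slice map. A second countable space has only countably
  -- many disjoint nonempty open sets.
  have hdisj : Pairwise (Function.onFun Disjoint fun X => (fun u => (g X)⁻¹ * u) ⁻¹' V) := by
    intro X Y hXY
    refine Set.disjoint_left.2 fun u hu hu' => hXY ?_
    obtain ⟨v, hv, hv'⟩ := interior_subset hu
    obtain ⟨w, hw, hw'⟩ := interior_subset hu'
    have e : ι.slice C ((X : C), v) = ι.slice C ((Y : C), w) := by
      simp only [slice, ← hg, ← map_mul]
      rw [hv', hw']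
      simp
    have := hinj (hab ⟨X.2.1, hv⟩) (hab ⟨Y.2.1, hw⟩) e
    exact Subtype.ext (Prod.ext_iff.1 this).1
  exact Set.countable_coe_iff.1 (hdisj.countable_of_isOpen_disjoint
    (fun X => isOpen_interior.preimage (continuous_const.mul continuous_id))
    fun X => ⟨g X, by simpa using hV⟩)

/-- A second countable Lie subgroup is weakly embedded: a map into it is smooth as soon as it is
smooth as a map into the ambient group. -/
theorem contMDiff_of_comp [SecondCountableTopology G] [LocallyConnectedSpace N] {f : N → G}
    (hf : ContMDiff J 𝓘(ℝ, EH) ∞ fun n => ι.toHom (f n)) : ContMDiff J 𝓘(ℝ, EG) ∞ f := by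
  intro n₀
  obtain ⟨C, hC⟩ := Submodule.exists_isCompl
    (LinearMap.range (tderiv 𝓘(ℝ, EG) 𝓘(ℝ, EH) ι.toHom 1).toLinearMap)
  obtain ⟨s, t, z, hs, ht, hinj, hz1, hz, hzt, hΨz⟩ := exists_local_inverse (ι.slice_zero C)
    (ι.contMDiffAt_slice C) (ι.bijective_tderiv_slice hC)
  obtain ⟨a, ha, b, hb, hab⟩ := mem_nhds_prod_iff.1 hs
  have hD := ι.countable_slices C hb hab hinj
  -- Left translation moves the base value to 1, where the slice coordinates live.
  let k : N → H := fun n => (ι.toHom (f n₀))⁻¹ * ι.toHom (f n)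
  have hk : ContMDiff J 𝓘(ℝ, EH) ∞ k := contMDiff_const.mul hf
  have hk0 : k n₀ = 1 := by simp [k]
  have hzk : ContMDiffAt J 𝓘(ℝ, C × EG) ∞ (fun n => z (k n)) n₀ :=
    ContMDiffAt.comp_of_eq (f := k) hz hk.contMDiffAt hk0
  have hzk0 : z (k n₀) = 0 := by rw [hk0, hz1]
  have hW : {n | k n ∈ t ∧ z (k n) ∈ a ×ˢ b} ∈ 𝓝 n₀ :=
    Filter.inter_mem (hk.continuous.continuousAt.preimage_mem_nhds (by rw [hk0]; exact ht))
      (hzk.continuousAt.preimage_mem_nhds (by rw [hzk0]; exact prod_mem_nhds ha hb))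
  obtain ⟨W, hWn, hWc, hWs⟩ := locallyConnectedSpace_iff_connected_subsets.1 ‹_› n₀ _ hW
  have hmem : ∀ n ∈ W, (z (k n)).1 ∈ {X ∈ a | chartParam (1 : H) (X : EH) ∈ ι.toHom.range} := by
    intro n hn
    refine ⟨(hWs hn).2.1, (f n₀)⁻¹ * f n * (chartParam (1 : G) (z (k n)).2)⁻¹, ?_⟩
    have := hΨz _ (hWs hn).1
    rw [map_mul, map_mul, map_inv, map_inv]
    change k n * _ = _
    rw [mul_inv_eq_iff_eq_mul]
    exact this.symm
  have hcont : ContinuousOn (fun n => (z (k n)).1) W :=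
    continuous_fst.comp_continuousOn (hzt.comp hk.continuous.continuousOn fun n hn => (hWs hn).1)
  -- On the connected neighbourhood W the transverse coordinate is continuous with values in a
  -- countable set, hence constant. So `f` stays in the slice through 1 and is read off from the
  -- smooth coordinate along G.
  have hsub := hD.isTotallyDisconnected _ (Set.image_subset_iff.2 hmem) (hWc.image _ hcont)
  have hn₀ := mem_of_mem_nhds hWn
  have key : ∀ n ∈ W, f n = f n₀ * chartParam (1 : G) (z (k n)).2 := by
    intro n hn
    have h0 : (z (k n)).1 = 0 := by
      have := hsub ⟨n, hn, rfl⟩ ⟨n₀, hn₀, rfl⟩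
      dsimp only at this
      rw [this, hzk0, Prod.fst_zero]
    have := hΨz _ (hWs hn).1
    rw [slice, h0] at this
    simp only [Submodule.coe_zero, chartParam_zero, one_mul, k] at this
    apply ι.injective
    rw [map_mul, this, mul_inv_cancel_left]
  have hsm : ContMDiffAt J 𝓘(ℝ, EG) ∞ (fun n => f n₀ * chartParam (1 : G) (z (k n)).2) n₀ := by
    refine contMDiffAt_const.mul ?_
    refine ContMDiffAt.comp_of_eq (f := fun n => (z (k n)).2) (contMDiffAt_chartParam (1 : G)) ?_ ?_
    · exact ContMDiffAt.comp (f := fun n => z (k n)) n₀ contDiff_snd.contMDiff.contMDiffAt hzk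
    · rw [hzk0, Prod.snd_zero]
  exact hsm.congr_of_eventuallyEq (Filter.mem_of_superset hWn key)

end LieSubgroupInclusion

end WeakEmbedding

/-- Makes the weak embedding argument applicable to maps defined on M × G and Q × G. -/
instance ModelProd.locallyConnectedSpace {K K' : Type*} [TopologicalSpace K] [TopologicalSpace K']
    [LocallyConnectedSpace K] [LocallyConnectedSpace K'] :
    LocallyConnectedSpace (ModelProd K K') :=
  inferInstanceAs (LocallyConnectedSpace (K × K'))

/-! ### The adjoint action and the Maurer–Cartan form. -/

section LieGroupCalculus

/-- With fixed base points the coordinate changes are those of a chart with itself, hence trivial.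
Smooth dependence of a differential on parameters then becomes plain smoothness. -/
theorem inTangentCoordinates_of_const {E E' : Type*} [NormedAddCommGroup E] [NormedSpace ℝ E]
    [NormedAddCommGroup E'] [NormedSpace ℝ E'] {K K' : Type*} [TopologicalSpace K]
    [TopologicalSpace K'] {I : ModelWithCorners ℝ E K} {I' : ModelWithCorners ℝ E' K'}
    {M M' N : Type*} [TopologicalSpace M] [ChartedSpace K M] [IsManifold I 1 M]
    [TopologicalSpace M'] [ChartedSpace K' M'] [IsManifold I' 1 M'] {f : N → M} {g : N → M'}
    {x : M} {y : M'} (hf : ∀ n, f n = x) (hg : ∀ n, g n = y) (φ : N → E →L[ℝ] E') (n₀ n : N) :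
    inTangentCoordinates I I' f g φ n₀ n = φ n := by
  obtain rfl : f = fun _ => x := funext hf
  obtain rfl : g = fun _ => y := funext hg
  rw [inTangentCoordinates_eq _ _ _ (mem_chart_source K x) (mem_chart_source K' y)]
  have e : ∀ X : E, (tangentBundleCore I M).coordChange (achart K x) (achart K x) x X = X :=
    fun X => tangentCoordChange_self (I := I) (mem_extChartAt_source x)
  have e' : ∀ X : E', (tangentBundleCore I' M').coordChange (achart K' y) (achart K' y) y X = X :=
    fun X => tangentCoordChange_self (I := I') (mem_extChartAt_source y)
  refine ContinuousLinearMap.ext fun X => ?_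
  rw [ContinuousLinearMap.comp_apply, ContinuousLinearMap.comp_apply, e, e']

variable {E : Type*} [NormedAddCommGroup E] [NormedSpace ℝ E]
  {G : Type*} [TopologicalSpace G] [ChartedSpace E G] [Group G]

/-- The adjoint action, as a linear endomorphism of the model space. -/
def adE (a : G) : E →L[ℝ] E := AdjointAction E a

theorem adE_apply (a : G) (X : E) :
    adE a X = tderiv 𝓘(ℝ, E) 𝓘(ℝ, E) (fun g : G => a * g * a⁻¹) 1 X := rfl

/-- The left invariant Maurer–Cartan form `ξ ↦ a⁻¹ ξ`. -/
def maurerCartan (a : G) : E →L[ℝ] E := tderiv 𝓘(ℝ, E) 𝓘(ℝ, E) (fun b : G => a⁻¹ * b) a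

variable [LieGroup 𝓘(ℝ, E) ∞ G]

theorem mdifferentiableAt_mulLeft (a b : G) :
    MDifferentiableAt 𝓘(ℝ, E) 𝓘(ℝ, E) (fun g : G => a * g) b :=
  (contMDiff_mul_left (n := ∞)).contMDiffAt.mdifferentiableAt (by simp)

theorem mdifferentiableAt_mulRight (a b : G) :
    MDifferentiableAt 𝓘(ℝ, E) 𝓘(ℝ, E) (fun g : G => g * a) b :=
  (contMDiff_mul_right (n := ∞)).contMDiffAt.mdifferentiableAt (by simp)

theorem contMDiff_conj : ContMDiff (𝓘(ℝ, E).prod 𝓘(ℝ, E)) 𝓘(ℝ, E) ∞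
    (fun p : G × G => p.1 * p.2 * p.1⁻¹) :=
  (contMDiff_fst.mul contMDiff_snd).mul (contMDiff_inv 𝓘(ℝ, E) ∞ |>.comp contMDiff_fst)

theorem mdifferentiableAt_conj (a b : G) :
    MDifferentiableAt 𝓘(ℝ, E) 𝓘(ℝ, E) (fun g : G => a * g * a⁻¹) b :=
  ((contMDiff_const.mul contMDiff_id).mul contMDiff_const : ContMDiff 𝓘(ℝ, E) 𝓘(ℝ, E) ∞
    (fun g : G => a * g * a⁻¹)).contMDiffAt.mdifferentiableAt (by simp)

theorem adE_one (X : E) : adE (1 : G) X = X := by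
  rw [adE_apply]
  simp only [one_mul, inv_one, mul_one]
  exact tderiv_id _ _

theorem adE_mul (a b : G) (X : E) : adE (a * b) X = adE a (adE b X) := by
  simp only [adE_apply]
  rw [← tderiv_comp (mdifferentiableAt_conj a 1) (mdifferentiableAt_conj b 1) (by simp)]
  simp only [mul_inv_rev, mul_assoc]

theorem adE_inv_adE (a : G) (X : E) : adE a⁻¹ (adE a X) = X := by
  rw [← adE_mul, inv_mul_cancel, adE_one]

theorem adE_adE_inv (a : G) (X : E) : adE a (adE a⁻¹ X) = X := by
  rw [← adE_mul, mul_inv_cancel, adE_one]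

/-- (ab)⁻¹(ξb) = b⁻¹(a⁻¹ξ)b. -/
theorem maurerCartan_mul_right (a b : G) (ξ : E) :
    maurerCartan (a * b) (tderiv 𝓘(ℝ, E) 𝓘(ℝ, E) (fun g : G => g * b) a ξ) =
      adE b⁻¹ (maurerCartan a ξ) := by
  rw [maurerCartan, maurerCartan, adE_apply,
    ← tderiv_comp (mdifferentiableAt_mulLeft _ _) (mdifferentiableAt_mulRight b a) rfl,
    ← tderiv_comp (mdifferentiableAt_conj b⁻¹ 1) (mdifferentiableAt_mulLeft a⁻¹ a) (by simp)]
  simp only [mul_inv_rev, inv_inv, mul_assoc]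

theorem maurerCartan_mul_left (a : G) (X : E) :
    maurerCartan a (tderiv 𝓘(ℝ, E) 𝓘(ℝ, E) (fun g : G => a * g) 1 X) = X := by
  rw [maurerCartan,
    ← tderiv_comp (mdifferentiableAt_mulLeft a⁻¹ a) (mdifferentiableAt_mulLeft a 1) (mul_one a)]
  simp only [inv_mul_cancel_left]
  exact tderiv_id _ _

theorem contMDiff_adE : ContMDiff 𝓘(ℝ, E) 𝓘(ℝ, E →L[ℝ] E) ∞ (adE : G → E →L[ℝ] E) := by
  have : IsManifold 𝓘(ℝ, E) 1 G := .of_le (n := ∞) (by simp)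
  intro a₀
  have h := ContMDiffAt.mfderiv (x₀ := a₀) (m := ∞) (fun a g : G => a * g * a⁻¹) (fun _ => (1 : G))
    (contMDiff_conj (E := E)).contMDiffAt contMDiffAt_const le_rfl
  exact h.congr_of_eventuallyEq (Filter.Eventually.of_forall fun a =>
    (inTangentCoordinates_of_const (x := (1 : G)) (y := (1 : G)) (fun _ => rfl)
      (fun b => by simp) adE a₀ a).symm)

/-- The form is the tangent map of (a, b) ↦ a⁻¹b on the vectors (0, v) over the diagonal. All values
lie over the single point 1, so their vector parts are smooth. -/
theorem contMDiff_maurerCartan : ContMDiff 𝓘(ℝ, E).tangent 𝓘(ℝ, E) ∞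
    (fun v : TangentBundle 𝓘(ℝ, E) G => maurerCartan v.proj (show E from v.snd)) := by
  have : IsManifold 𝓘(ℝ, E) 1 G := .of_le (n := ∞) (by simp)
  have hdiv : ContMDiff (𝓘(ℝ, E).prod 𝓘(ℝ, E)) 𝓘(ℝ, E) ∞ (fun p : G × G => p.1⁻¹ * p.2) :=
    (contMDiff_inv 𝓘(ℝ, E) ∞ |>.comp contMDiff_fst).mul contMDiff_snd
  have hzero : ContMDiff 𝓘(ℝ, E).tangent 𝓘(ℝ, E).tangent ∞
      (fun v : TangentBundle 𝓘(ℝ, E) G => zeroSection E (TangentSpace 𝓘(ℝ, E)) v.proj) :=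
    (contMDiff_zeroSection ℝ (TangentSpace 𝓘(ℝ, E) : G → Type _)).comp
      (contMDiff_proj (TangentSpace 𝓘(ℝ, E) : G → Type _))
  have h := (hdiv.contMDiff_tangentMap (m := ∞) le_rfl).comp
    (contMDiff_equivTangentBundleProd_symm.comp (hzero.prodMk contMDiff_id))
  intro v
  have h' := contMDiffAt_snd_of_proj_eq (c := (1 : G)) (fun w => inv_mul_cancel w.proj)
    (h.contMDiffAt (x := v))
  refine h'.congr_of_eventuallyEq (Filter.Eventually.of_forall fun w => ?_)
  have e := mfderiv_prod_eq_add_apply (p := (w.proj, w.proj)) (v := ((0 : E), (show E from w.snd)))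
    (hdiv.contMDiffAt.mdifferentiableAt (by simp))
  refine Eq.trans ?_ e.symm
  change _ = tderiv 𝓘(ℝ, E) 𝓘(ℝ, E) (fun b : G => b⁻¹ * w.proj) w.proj 0 +
    maurerCartan w.proj (show E from w.snd)
  rw [map_zero, zero_add]

end LieGroupCalculus

/-! ### Conjugation of G by its normaliser, and the inclusion of Lie algebras. -/

namespace LieSubgroupInclusion

variable {EG : Type*} [NormedAddCommGroup EG] [NormedSpace ℝ EG]
  {EH : Type*} [NormedAddCommGroup EH] [NormedSpace ℝ EH]
  {G : Type*} [TopologicalSpace G] [ChartedSpace EG G] [Group G]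
  {H : Type*} [TopologicalSpace H] [ChartedSpace EH H] [Group H]

/-- The inclusion of Lie algebras, as a linear map between the model spaces. -/
def lieE (ι : LieSubgroupInclusion EG EH G H) : EG →L[ℝ] EH :=
  tderiv 𝓘(ℝ, EG) 𝓘(ℝ, EH) ι.toHom 1

variable (ι : LieSubgroupInclusion EG EH G H)

theorem lieE_injective : Function.Injective ι.lieE := ι.immersive 1

theorem mdifferentiableAt (g : G) : MDifferentiableAt 𝓘(ℝ, EG) 𝓘(ℝ, EH) ι.toHom g :=
  ι.contMDiff.contMDiffAt.mdifferentiableAt (by simp)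

/-- Conjugation by an element of the normaliser, as a map `G → G`. -/
def conj (a : H) (g : G) : G := Function.invFun ι.toHom (a * ι.toHom g * a⁻¹)

theorem toHom_conj {a : H} (ha : a ∈ Subgroup.normalizer (ι.toHom.range : Set H)) (g : G) :
    ι.toHom (ι.conj a g) = a * ι.toHom g * a⁻¹ :=
  Function.invFun_eq ((Subgroup.mem_normalizer_iff.1 ha (ι.toHom g)).1 ⟨g, rfl⟩)

theorem conj_mul {a : H} (ha : a ∈ Subgroup.normalizer (ι.toHom.range : Set H)) (g g' : G) :
    ι.conj a (g * g') = ι.conj a g * ι.conj a g' := by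
  apply ι.injective
  simp [ι.toHom_conj ha]

theorem conj_one {a : H} (ha : a ∈ Subgroup.normalizer (ι.toHom.range : Set H)) :
    ι.conj a 1 = 1 := by
  apply ι.injective
  simp [ι.toHom_conj ha]

theorem conj_inv_conj {a : H} (ha : a ∈ Subgroup.normalizer (ι.toHom.range : Set H)) (g : G) :
    ι.conj a⁻¹ (ι.conj a g) = g := by
  apply ι.injective
  rw [ι.toHom_conj (inv_mem ha), ι.toHom_conj ha]
  group

theorem conj_conj_inv {a : H} (ha : a ∈ Subgroup.normalizer (ι.toHom.range : Set H)) (g : G) :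
    ι.conj a (ι.conj a⁻¹ g) = g := by
  simpa using ι.conj_inv_conj (inv_mem ha) g

variable [LieGroup 𝓘(ℝ, EG) ∞ G] [LieGroup 𝓘(ℝ, EH) ∞ H]

theorem lieE_adE (g : G) (X : EG) : ι.lieE (adE g X) = adE (ι.toHom g) (ι.lieE X) := by
  rw [lieE, adE_apply, adE_apply,
    ← tderiv_comp (ι.mdifferentiableAt 1) (mdifferentiableAt_conj g 1) (by simp),
    ← tderiv_comp (mdifferentiableAt_conj _ 1) (ι.mdifferentiableAt 1) (map_one _)]
  simp only [map_mul, map_inv]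

theorem lieE_maurerCartan (g : G) (ξ : EG) :
    ι.lieE (maurerCartan g ξ) =
      maurerCartan (ι.toHom g) (tderiv 𝓘(ℝ, EG) 𝓘(ℝ, EH) ι.toHom g ξ) := by
  rw [lieE, maurerCartan, maurerCartan,
    ← tderiv_comp (ι.mdifferentiableAt 1) (mdifferentiableAt_mulLeft _ g) (by simp),
    ← tderiv_comp (mdifferentiableAt_mulLeft _ _) (ι.mdifferentiableAt g) rfl]
  simp only [map_mul, map_inv]

variable [FiniteDimensional ℝ EG] [FiniteDimensional ℝ EH] [SecondCountableTopology G]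

/-- Smoothness into H is immediate; weak embedding upgrades it to smoothness into G. This is where
second countability of G enters. -/
theorem contMDiff_conj_comp {E : Type*} [NormedAddCommGroup E] [NormedSpace ℝ E]
    {K : Type*} [TopologicalSpace K] [LocallyConnectedSpace K] {I : ModelWithCorners ℝ E K}
    {M : Type*} [TopologicalSpace M] [ChartedSpace K M] {a : M → H} {g : M → G}
    (ha : ContMDiff I 𝓘(ℝ, EH) ∞ a) (hg : ContMDiff I 𝓘(ℝ, EG) ∞ g)
    (hN : ∀ x, a x ∈ Subgroup.normalizer (ι.toHom.range : Set H)) :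
    ContMDiff I 𝓘(ℝ, EG) ∞ (fun x => ι.conj (a x) (g x)) := by
  have : LocallyConnectedSpace M := ChartedSpace.locallyConnectedSpace K M
  refine ι.contMDiff_of_comp ?_
  simp only [ι.toHom_conj (hN _)]
  exact contMDiff_conj.comp (ha.prodMk (ι.contMDiff.comp hg))

/-- The adjoint action of the normaliser of `G` preserves `𝔤`. -/
theorem adE_lieE_mem_range {a : H} (ha : a ∈ Subgroup.normalizer (ι.toHom.range : Set H)) (X : EG) :
    adE a (ι.lieE X) ∈ LinearMap.range ι.lieE.toLinearMap := by
  have hc : ContMDiff 𝓘(ℝ, EG) 𝓘(ℝ, EG) ∞ (ι.conj a) :=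
    ι.contMDiff_conj_comp contMDiff_const contMDiff_id fun _ => ha
  refine ⟨tderiv 𝓘(ℝ, EG) 𝓘(ℝ, EG) (ι.conj a) 1 X, ?_⟩
  change ι.lieE _ = _
  rw [lieE, adE_apply, ← tderiv_comp (ι.mdifferentiableAt 1)
      (hc.contMDiffAt.mdifferentiableAt (by simp)) (ι.conj_one ha),
    ← tderiv_comp (mdifferentiableAt_conj _ 1) (ι.mdifferentiableAt 1) (map_one _)]
  simp only [ι.toHom_conj ha]

end LieSubgroupInclusion

/-! ### The projection onto 𝔤 of an invariant splitting. -/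

namespace IsInvariantSplitting

variable {EG : Type*} [NormedAddCommGroup EG] [NormedSpace ℝ EG]
  {EH : Type*} [NormedAddCommGroup EH] [NormedSpace ℝ EH]
  {G : Type*} [TopologicalSpace G] [ChartedSpace EG G] [Group G]
  {H : Type*} [TopologicalSpace H] [ChartedSpace EH H] [Group H]
  {ι : LieSubgroupInclusion EG EH G H} {𝔪 : Submodule ℝ (GroupLieAlgebra 𝓘(ℝ, EH) H)}

/-- The projection `𝔥 → 𝔤` along `𝔪`, as a linear map between the model spaces. -/
def prE (hm : IsInvariantSplitting ι 𝔪) : EH →ₗ[ℝ] EG := hm.pr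

variable (hm : IsInvariantSplitting ι 𝔪)

theorem prE_lieE (X : EG) : hm.prE (ι.lieE X) = X :=
  LinearMap.linearProjOfIsCompl_apply_left _ _ (ι.immersive 1) hm.isCompl X

theorem lieE_prE_of_mem {X : EH} (hX : X ∈ LinearMap.range ι.lieE.toLinearMap) :
    ι.lieE (hm.prE X) = X := by
  obtain ⟨Y, rfl⟩ := hX
  exact congrArg ι.lieE (hm.prE_lieE Y)

theorem prE_eq_zero {X : GroupLieAlgebra 𝓘(ℝ, EH) H} (hX : X ∈ 𝔪) : hm.prE X = 0 :=
  LinearMap.linearProjOfIsCompl_apply_right' _ _ (ι.immersive 1) hm.isCompl X hX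

theorem exists_decomposition (hm : IsInvariantSplitting ι 𝔪) (X : EH) :
    ∃ (Y : EG) (Z : EH), (show GroupLieAlgebra 𝓘(ℝ, EH) H from Z) ∈ 𝔪 ∧ X = ι.lieE Y + Z := by
  have hX : (show GroupLieAlgebra 𝓘(ℝ, EH) H from X) ∈ LinearMap.range ι.lie.toLinearMap ⊔ 𝔪 :=
    hm.isCompl.sup_eq_top ▸ Submodule.mem_top
  obtain ⟨_, ⟨Y, rfl⟩, Z, hZ, h⟩ := Submodule.mem_sup.1 hX
  exact ⟨Y, Z, hZ, h.symm⟩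

/-- Ad(g) preserves both summands 𝔤 and 𝔪, so it commutes with the projection. -/
theorem prE_adE [LieGroup 𝓘(ℝ, EG) ∞ G] [LieGroup 𝓘(ℝ, EH) ∞ H] (g : G) (X : EH) :
    hm.prE (adE (ι.toHom g) X) = adE g (hm.prE X) := by
  obtain ⟨Y, Z, hZ, rfl⟩ := hm.exists_decomposition X
  have h := hm.prE_eq_zero (hm.invariant g Z hZ)
  change hm.prE (adE (ι.toHom g) Z) = 0 at h
  rw [map_add, map_add, map_add, h, hm.prE_eq_zero hZ, ← ι.lieE_adE, hm.prE_lieE, hm.prE_lieE,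
    add_zero, add_zero]

end IsInvariantSplitting

/-! ### Local sections and the fundamental formula for connection forms. -/

namespace PrincipalBundle

variable {EM : Type*} [NormedAddCommGroup EM] [NormedSpace ℝ EM]
    {EH : Type*} [NormedAddCommGroup EH] [NormedSpace ℝ EH]
    {EP : Type*} [NormedAddCommGroup EP] [NormedSpace ℝ EP]
    {M : Type*} [TopologicalSpace M] [ChartedSpace EM M]
    {H : Type*} [TopologicalSpace H] [ChartedSpace EH H] [Group H]
    {P : Type*} [TopologicalSpace P] [ChartedSpace EP P]
    (B : PrincipalBundle EM EH EP M H P)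

theorem contMDiff_proj : ContMDiff 𝓘(ℝ, EP) 𝓘(ℝ, EM) ∞ B.proj := by
  intro p
  obtain ⟨e, he, hsm, -, -⟩ := B.locallyTrivial (B.proj p)
  have hp : e.source ∈ 𝓝 p := e.open_source.mem_nhds (e.mem_source.2 he)
  have h : ContMDiffAt 𝓘(ℝ, EP) 𝓘(ℝ, EM) ∞ (fun p => (e p).1) p :=
    contMDiffAt_fst.comp p (hsm.contMDiffAt hp)
  exact h.congr_of_eventuallyEq (Filter.mem_of_superset hp fun q hq => (e.coe_fst hq).symm)

theorem exists_local_section (x : M) : ∃ (U : Set M) (σ : M → P) (β : P → H), IsOpen U ∧ x ∈ U ∧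
    ContMDiffOn 𝓘(ℝ, EM) 𝓘(ℝ, EP) ∞ σ U ∧
    ContMDiffOn 𝓘(ℝ, EP) 𝓘(ℝ, EH) ∞ β (B.proj ⁻¹' U) ∧
    (∀ y ∈ U, B.proj (σ y) = y) ∧
    (∀ p, B.proj p ∈ U → B.act (σ (B.proj p)) (β p) = p) ∧
    ∀ p, B.proj p ∈ U → ∀ a, β (B.act p a) = β p * a := by
  obtain ⟨e, he, hsm, hsm', hact⟩ := B.locallyTrivial x
  have hproj : ∀ y ∈ e.baseSet, B.proj (e.toOpenPartialHomeomorph.symm (y, 1)) = y :=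
    fun y hy => e.proj_symm_apply' hy
  refine ⟨e.baseSet, fun y => e.toOpenPartialHomeomorph.symm (y, 1), fun p => (e p).2,
    e.open_baseSet, he, ?_, ?_, hproj, ?_, ?_⟩
  · refine hsm'.comp (contMDiffOn_id.prodMk contMDiffOn_const) fun y hy => ?_
    exact e.mem_target.2 hy
  · rw [← e.source_eq]
    exact contMDiff_snd.comp_contMDiffOn hsm
  · intro p hp
    have h1 : e.toOpenPartialHomeomorph.symm (B.proj p, 1) ∈ e.source :=
      e.mem_source.2 (by rwa [hproj _ hp])
    have h2 : p ∈ e.source := e.mem_source.2 hp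
    have h3 : B.act (e.toOpenPartialHomeomorph.symm (B.proj p, 1)) (e p).2 ∈ e.source :=
      e.mem_source.2 (by rwa [B.proj_act, hproj _ hp])
    refine e.toOpenPartialHomeomorph.injOn h3 h2 ?_
    change e _ = e p
    rw [hact _ h1, e.apply_symm_apply' hp, one_mul, ← e.coe_fst h2]
  · intro p hp a
    exact congrArg Prod.snd (hact _ (e.mem_source.2 hp) a)

theorem contMDiff_act_right (a : H) :
    ContMDiff 𝓘(ℝ, EP) 𝓘(ℝ, EP) ∞ (fun p => B.act p a) :=
  B.contMDiff_act.comp (contMDiff_id.prodMk contMDiff_const)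

theorem contMDiff_act_left (p : P) :
    ContMDiff 𝓘(ℝ, EH) 𝓘(ℝ, EP) ∞ (fun a => B.act p a) :=
  B.contMDiff_act.comp (contMDiff_const.prodMk contMDiff_id)

theorem act_act_inv (p : P) (a : H) : B.act (B.act p a) a⁻¹ = p := by
  rw [← B.act_mul, mul_inv_cancel, B.act_one]

/-- The defining properties of a connection form on the fibre over `x`. -/
structure IsConnectionOver (η : P → EP →L[ℝ] EH) (x : M) : Prop where
  equivariant : ∀ p, B.proj p = x → ∀ (a : H) (v : EP),
    η (B.act p a) (tderiv 𝓘(ℝ, EP) 𝓘(ℝ, EP) (fun p => B.act p a) p v) = adE a⁻¹ (η p v)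
  fundamental : ∀ p, B.proj p = x → ∀ X : EH,
    η p (tderiv 𝓘(ℝ, EH) 𝓘(ℝ, EP) (fun a => B.act p a) 1 X) = X

variable {B}

/-- The value of a connection form on the velocity of a family `q(n) a(n)`. -/
theorem IsConnectionOver.apply_act [LieGroup 𝓘(ℝ, EH) ∞ H]
    {η : P → EP →L[ℝ] EH} {x : M} (hη : B.IsConnectionOver η x)
    {F L N : Type*} [NormedAddCommGroup F] [NormedSpace ℝ F] [TopologicalSpace L]
    [TopologicalSpace N] [ChartedSpace L N] {J : ModelWithCorners ℝ F L}
    {q : N → P} {a : N → H} {n : N} (hq : MDifferentiableAt J 𝓘(ℝ, EP) q n)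
    (ha : MDifferentiableAt J 𝓘(ℝ, EH) a n) (hx : B.proj (q n) = x) (v : F) :
    η (B.act (q n) (a n)) (tderiv J 𝓘(ℝ, EP) (fun n => B.act (q n) (a n)) n v) =
      adE (a n)⁻¹ (η (q n) (tderiv J 𝓘(ℝ, EP) q n v)) +
        maurerCartan (a n) (tderiv J 𝓘(ℝ, EH) a n v) := by
  have e := tderiv_comp₂ (f := fun x : P × H => B.act x.1 x.2)
    (B.contMDiff_act.contMDiffAt.mdifferentiableAt (by simp)) hq ha v
  -- Since q·b = (q·a)·(a⁻¹b), the vertical part of the velocity is the fundamental vector of a⁻¹ȧ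
  -- at q·a.
  have e2 : tderiv 𝓘(ℝ, EH) 𝓘(ℝ, EP) (fun b => B.act (q n) b) (a n) (tderiv J 𝓘(ℝ, EH) a n v) =
      tderiv 𝓘(ℝ, EH) 𝓘(ℝ, EP) (fun b => B.act (B.act (q n) (a n)) b) 1
        (maurerCartan (a n) (tderiv J 𝓘(ℝ, EH) a n v)) := by
    rw [maurerCartan, ← tderiv_comp
      ((B.contMDiff_act_left _).contMDiffAt.mdifferentiableAt (by simp))
      (mdifferentiableAt_mulLeft _ _) (inv_mul_cancel _)]
    simp only [← B.act_mul, mul_inv_cancel_left]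
  rw [e, map_add, e2, hη.equivariant _ hx, hη.fundamental _ ((B.proj_act _ _).trans hx)]

end PrincipalBundle

/-! ### Compatible local trivialisations of P and Q. -/

namespace PrincipalSubbundle

variable {EM : Type*} [NormedAddCommGroup EM] [NormedSpace ℝ EM]
    {EG : Type*} [NormedAddCommGroup EG] [NormedSpace ℝ EG]
    {EH : Type*} [NormedAddCommGroup EH] [NormedSpace ℝ EH]
    {EP : Type*} [NormedAddCommGroup EP] [NormedSpace ℝ EP]
    {M : Type*} [TopologicalSpace M] [ChartedSpace EM M]
    {G : Type*} [TopologicalSpace G] [ChartedSpace EG G] [Group G]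
    {H : Type*} [TopologicalSpace H] [ChartedSpace EH H] [Group H] [LieGroup 𝓘(ℝ, EH) ∞ H]
    {P : Type*} [TopologicalSpace P] [ChartedSpace EP P]
    {B : PrincipalBundle EM EH EP M H P} {ι : LieSubgroupInclusion EG EH G H}
    {EQ : Type*} [NormedAddCommGroup EQ] [NormedSpace ℝ EQ]
    {Q : Type*} [TopologicalSpace Q] [ChartedSpace EQ Q]

/-- Compatible local trivialisations of a principal bundle and a subbundle, over an open set `U`:
a local section `σ` of the subbundle, and the group coordinates `α` and `γ` relative to `σ`. -/
structure LocalTriv (S : PrincipalSubbundle B ι EQ Q) where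
  U : Set M
  σ : M → Q
  α : P → H
  γ : Q → G
  isOpen : IsOpen U
  contMDiffOn_σ : ContMDiffOn 𝓘(ℝ, EM) 𝓘(ℝ, EQ) ∞ σ U
  contMDiffOn_α : ContMDiffOn 𝓘(ℝ, EP) 𝓘(ℝ, EH) ∞ α (B.proj ⁻¹' U)
  contMDiffOn_γ : ContMDiffOn 𝓘(ℝ, EQ) 𝓘(ℝ, EG) ∞ γ (S.proj ⁻¹' U)
  proj_σ : ∀ y ∈ U, S.proj (σ y) = y
  act_α : ∀ p, B.proj p ∈ U → B.act (S.incl (σ (B.proj p))) (α p) = p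
  α_act : ∀ p, B.proj p ∈ U → ∀ a, α (B.act p a) = α p * a
  act_γ : ∀ q, S.proj q ∈ U → S.act (σ (S.proj q)) (γ q) = q
  α_incl : ∀ q, S.proj q ∈ U → α (S.incl q) = ι.toHom (γ q)

theorem exists_localTriv (S : PrincipalSubbundle B ι EQ Q) (x : M) :
    ∃ t : S.LocalTriv, x ∈ t.U := by
  obtain ⟨U, τ, β, hU, hxU, -, hβ, hτβ, hτ, hβa⟩ := B.exists_local_section x
  obtain ⟨V, σ, γ, hV, hxV, hσ, hγ, hσγ, hs, hγa⟩ := S.toPrincipalBundle.exists_local_section x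
  have hπ : ∀ y ∈ V, B.proj (S.incl (σ y)) = y := fun y hy => by rw [S.proj_incl, hσγ y hy]
  have hβσ : ContMDiffOn 𝓘(ℝ, EM) 𝓘(ℝ, EH) ∞ (fun y => β (S.incl (σ y))) (U ∩ V) :=
    hβ.comp (S.contMDiff_incl.comp_contMDiffOn (hσ.mono Set.inter_subset_right))
      fun y hy => by simpa [hπ y hy.2] using hy.1
  refine ⟨{
    U := U ∩ V
    σ := σ
    -- The coordinate β is relative to a section of P unrelated to Q; dividing by its value on σ
    -- makes the coordinate relative to σ.
    α := fun p => (β (S.incl (σ (B.proj p))))⁻¹ * β p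
    γ := γ
    isOpen := hU.inter hV
    contMDiffOn_σ := hσ.mono Set.inter_subset_right
    contMDiffOn_α := (hβσ.comp B.contMDiff_proj.contMDiffOn fun p hp => hp).inv.mul
      (hβ.mono fun p hp => hp.1)
    contMDiffOn_γ := hγ.mono fun q hq => hq.2
    proj_σ := fun y hy => hσγ y hy.2
    act_α := fun p hp => ?_
    α_act := fun p hp a => by simp only [B.proj_act, hβa p hp.1, mul_assoc]
    act_γ := fun q hq => hs q hq.2
    α_incl := fun q hq => ?_ }, hxU, hxV⟩
  · have h := hτ (S.incl (σ (B.proj p))) (by simpa [hπ _ hp.2] using hp.1)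
    rw [hπ _ hp.2] at h
    calc B.act (S.incl (σ (B.proj p))) ((β (S.incl (σ (B.proj p))))⁻¹ * β p)
        = B.act (B.act (τ (B.proj p)) (β (S.incl (σ (B.proj p)))))
            ((β (S.incl (σ (B.proj p))))⁻¹ * β p) := by rw [h]
      _ = p := by rw [← B.act_mul, mul_inv_cancel_left, hτ p hp.1]
  · have h : β (S.incl (S.act (σ (S.proj q)) (γ q))) =
        β (S.incl (σ (S.proj q))) * ι.toHom (γ q) := by
      rw [S.incl_act]
      exact hβa _ (by simpa [hπ _ hq.2] using hq.1) _
    rw [hs q hq.2] at h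
    rw [S.proj_incl, h, inv_mul_cancel_left]

end PrincipalSubbundle

/-! ### Connections in terms of their fibrewise conditions. -/

namespace PrincipalBundle

variable {EM : Type*} [NormedAddCommGroup EM] [NormedSpace ℝ EM]
    {EH : Type*} [NormedAddCommGroup EH] [NormedSpace ℝ EH]
    {EP : Type*} [NormedAddCommGroup EP] [NormedSpace ℝ EP]
    {M : Type*} [TopologicalSpace M] [ChartedSpace EM M]
    {H : Type*} [TopologicalSpace H] [ChartedSpace EH H] [Group H]
    {P : Type*} [TopologicalSpace P] [ChartedSpace EP P] [IsManifold 𝓘(ℝ, EP) ∞ P]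
    {B : PrincipalBundle EM EH EP M H P}

theorem IsConnectionOver.congr {η η' : P → EP →L[ℝ] EH} {x : M} (hη : B.IsConnectionOver η x)
    (h : ∀ p, B.proj p = x → η' p = η p) : B.IsConnectionOver η' x where
  equivariant p hp a v := by
    rw [h p hp, h _ ((B.proj_act p a).trans hp), hη.equivariant p hp]
  fundamental p hp X := by rw [h p hp, hη.fundamental p hp]

namespace Connection

/-- The connection form, with values in the linear maps between the model spaces. -/
def formE (A : B.Connection) (p : P) : EP →L[ℝ] EH := A.form p

theorem ext_formE {A A' : B.Connection} (h : ∀ p v, A.formE p v = A'.formE p v) : A = A' :=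
  Connection.ext (funext fun p => ContinuousLinearMap.ext (h p))

theorem isConnectionOver (A : B.Connection) (x : M) : B.IsConnectionOver A.formE x where
  equivariant p _ a v := A.equivariant a p v
  fundamental p _ X := by
    have h := A.fundamental p X
    change A.formE (B.act p 1) (tderiv 𝓘(ℝ, EH) 𝓘(ℝ, EP) (fun a => B.act p a) 1 X) = X at h
    rwa [B.act_one] at h

/-- A connection from a smooth form satisfying the fibrewise conditions. -/
def ofFormE (η : P → EP →L[ℝ] EH)
    (hs : ContMDiff 𝓘(ℝ, EP).tangent 𝓘(ℝ, EH) ∞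
      fun v : TangentBundle 𝓘(ℝ, EP) P => η v.proj (show EP from v.snd))
    (hη : ∀ x, B.IsConnectionOver η x) : B.Connection where
  form := η
  smooth := hs
  equivariant a p v := (hη _).equivariant p rfl a v
  fundamental p X := by
    change η (B.act p 1) (tderiv 𝓘(ℝ, EH) 𝓘(ℝ, EP) (fun a => B.act p a) 1 X) = X
    rw [B.act_one]
    exact (hη _).fundamental p rfl X

theorem contMDiff_formE (A : B.Connection) : ContMDiff 𝓘(ℝ, EP).tangent 𝓘(ℝ, EH) ∞
    fun v : TangentBundle 𝓘(ℝ, EP) P => A.formE v.proj (show EP from v.snd) := A.smooth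

end Connection

end PrincipalBundle

/-! ### Existence and uniqueness of the extension of a connection. -/

namespace PrincipalSubbundle

variable {EM : Type*} [NormedAddCommGroup EM] [NormedSpace ℝ EM]
    {EG : Type*} [NormedAddCommGroup EG] [NormedSpace ℝ EG]
    {EH : Type*} [NormedAddCommGroup EH] [NormedSpace ℝ EH]
    {EP : Type*} [NormedAddCommGroup EP] [NormedSpace ℝ EP]
    {M : Type*} [TopologicalSpace M] [ChartedSpace EM M]
    {G : Type*} [TopologicalSpace G] [ChartedSpace EG G] [Group G] [LieGroup 𝓘(ℝ, EG) ∞ G]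
    {H : Type*} [TopologicalSpace H] [ChartedSpace EH H] [Group H] [LieGroup 𝓘(ℝ, EH) ∞ H]
    {P : Type*} [TopologicalSpace P] [ChartedSpace EP P] [IsManifold 𝓘(ℝ, EP) ∞ P]
    {B : PrincipalBundle EM EH EP M H P} {ι : LieSubgroupInclusion EG EH G H}
    {EQ : Type*} [NormedAddCommGroup EQ] [NormedSpace ℝ EQ]
    {Q : Type*} [TopologicalSpace Q] [ChartedSpace EQ Q] [IsManifold 𝓘(ℝ, EQ) ∞ Q]
    {S : PrincipalSubbundle B ι EQ Q}

theorem mdifferentiableAt_incl (S : PrincipalSubbundle B ι EQ Q) (q : Q) :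
    MDifferentiableAt 𝓘(ℝ, EQ) 𝓘(ℝ, EP) S.incl q :=
  S.contMDiff_incl.contMDiffAt.mdifferentiableAt (by simp)

namespace LocalTriv

variable (t : S.LocalTriv)

theorem isOpen_preimage : IsOpen (B.proj ⁻¹' t.U) :=
  t.isOpen.preimage B.contMDiff_proj.continuous

theorem contMDiffOn_σ_proj :
    ContMDiffOn 𝓘(ℝ, EP) 𝓘(ℝ, EQ) ∞ (fun p => t.σ (B.proj p)) (B.proj ⁻¹' t.U) :=
  t.contMDiffOn_σ.comp B.contMDiff_proj.contMDiffOn fun _ hp => hp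

theorem mdifferentiableAt_σ_proj {p : P} (hp : B.proj p ∈ t.U) :
    MDifferentiableAt 𝓘(ℝ, EP) 𝓘(ℝ, EQ) (fun p => t.σ (B.proj p)) p :=
  (t.contMDiffOn_σ_proj.contMDiffAt (t.isOpen_preimage.mem_nhds hp)).mdifferentiableAt (by simp)

theorem mdifferentiableAt_α {p : P} (hp : B.proj p ∈ t.U) :
    MDifferentiableAt 𝓘(ℝ, EP) 𝓘(ℝ, EH) t.α p :=
  (t.contMDiffOn_α.contMDiffAt (t.isOpen_preimage.mem_nhds hp)).mdifferentiableAt (by simp)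

/-- The extension of a connection on the subbundle to the part of the ambient bundle over `t.U`. -/
def extForm (A : S.Connection) (p : P) : EP →L[ℝ] EH :=
  (adE (t.α p)⁻¹).comp (ι.lieE.comp ((A.formE (t.σ (B.proj p))).comp
    (tderiv 𝓘(ℝ, EP) 𝓘(ℝ, EQ) (fun p => t.σ (B.proj p)) p))) +
  (maurerCartan (t.α p)).comp (tderiv 𝓘(ℝ, EP) 𝓘(ℝ, EH) t.α p)

variable (A : S.Connection)

theorem extForm_apply (p : P) (v : EP) :
    t.extForm A p v = adE (t.α p)⁻¹ (ι.lieE (A.formE (t.σ (B.proj p))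
      (tderiv 𝓘(ℝ, EP) 𝓘(ℝ, EQ) (fun p => t.σ (B.proj p)) p v))) +
    maurerCartan (t.α p) (tderiv 𝓘(ℝ, EP) 𝓘(ℝ, EH) t.α p v) := rfl

/-- Right translation by a leaves σ ∘ π unchanged and turns α into αa. On fundamental vectors the
σ-term vanishes and the Maurer–Cartan term returns the generator. -/
theorem isConnectionOver_extForm {x : M} (hx : x ∈ t.U) :
    B.IsConnectionOver (t.extForm A) x where
  equivariant p hp a v := by
    subst hp
    have hp' : B.proj (B.act p a) ∈ t.U := by rwa [B.proj_act]
    have hR : MDifferentiableAt 𝓘(ℝ, EP) 𝓘(ℝ, EP) (fun p => B.act p a) p :=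
      (B.contMDiff_act_right a).contMDiffAt.mdifferentiableAt (by simp)
    have e1 : tderiv 𝓘(ℝ, EP) 𝓘(ℝ, EQ) (fun p => t.σ (B.proj p)) (B.act p a)
        (tderiv 𝓘(ℝ, EP) 𝓘(ℝ, EP) (fun p => B.act p a) p v) =
        tderiv 𝓘(ℝ, EP) 𝓘(ℝ, EQ) (fun p => t.σ (B.proj p)) p v := by
      rw [← tderiv_comp (t.mdifferentiableAt_σ_proj hp') hR rfl]
      simp only [B.proj_act]
    have e2 : tderiv 𝓘(ℝ, EP) 𝓘(ℝ, EH) t.α (B.act p a)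
        (tderiv 𝓘(ℝ, EP) 𝓘(ℝ, EP) (fun p => B.act p a) p v) =
        tderiv 𝓘(ℝ, EH) 𝓘(ℝ, EH) (fun b => b * a) (t.α p)
          (tderiv 𝓘(ℝ, EP) 𝓘(ℝ, EH) t.α p v) := by
      rw [← tderiv_comp (t.mdifferentiableAt_α hp') hR rfl,
        ← tderiv_comp (mdifferentiableAt_mulRight a _) (t.mdifferentiableAt_α hx) rfl]
      refine DFunLike.congr_fun (tderiv_congr ?_) v
      filter_upwards [t.isOpen_preimage.mem_nhds hx] with p hp
      exact t.α_act p hp a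
    rw [extForm_apply, extForm_apply, e1, e2, t.α_act p hx, B.proj_act, maurerCartan_mul_right,
      mul_inv_rev, adE_mul, map_add]
  fundamental p hp X := by
    subst hp
    have hL : MDifferentiableAt 𝓘(ℝ, EH) 𝓘(ℝ, EP) (fun a => B.act p a) 1 :=
      (B.contMDiff_act_left p).contMDiffAt.mdifferentiableAt (by simp)
    have e1 : tderiv 𝓘(ℝ, EP) 𝓘(ℝ, EQ) (fun p => t.σ (B.proj p)) p
        (tderiv 𝓘(ℝ, EH) 𝓘(ℝ, EP) (fun a => B.act p a) 1 X) = 0 := by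
      rw [← tderiv_comp (t.mdifferentiableAt_σ_proj hx) hL (B.act_one p)]
      simp only [B.proj_act]
      exact tderiv_const _ _ _
    have e2 : tderiv 𝓘(ℝ, EP) 𝓘(ℝ, EH) t.α p
        (tderiv 𝓘(ℝ, EH) 𝓘(ℝ, EP) (fun a => B.act p a) 1 X) =
        tderiv 𝓘(ℝ, EH) 𝓘(ℝ, EH) (fun a => t.α p * a) 1 X := by
      rw [← tderiv_comp (t.mdifferentiableAt_α hx) hL (B.act_one p)]
      simp only [t.α_act p hx]
    rw [extForm_apply, e1, e2, maurerCartan_mul_left, map_zero, map_zero, map_zero, zero_add]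

/-- On Q the coordinate α is ι ∘ γ, so the expression is the image under 𝔤 → 𝔥 of the fundamental
formula for A on q = σ(π(q)) γ(q). -/
theorem extForm_incl {q : Q} (hp : B.proj (S.incl q) ∈ t.U) (w : EQ) :
    t.extForm A (S.incl q) (tderiv 𝓘(ℝ, EQ) 𝓘(ℝ, EP) S.incl q w) = ι.lieE (A.formE q w) := by
  have hq : S.proj q ∈ t.U := by rwa [S.proj_incl] at hp
  have hU : ∀ᶠ q in 𝓝 q, S.proj q ∈ t.U :=
    (t.isOpen.preimage S.toPrincipalBundle.contMDiff_proj.continuous).mem_nhds hq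
  have hσ : MDifferentiableAt 𝓘(ℝ, EQ) 𝓘(ℝ, EQ) (fun q => t.σ (S.proj q)) q :=
    ((t.contMDiffOn_σ.contMDiffAt (t.isOpen.mem_nhds hq)).comp q
      S.toPrincipalBundle.contMDiff_proj.contMDiffAt).mdifferentiableAt (by simp)
  have hγ : MDifferentiableAt 𝓘(ℝ, EQ) 𝓘(ℝ, EG) t.γ q :=
    (t.contMDiffOn_γ.contMDiffAt hU).mdifferentiableAt (by simp)
  have e1 : tderiv 𝓘(ℝ, EP) 𝓘(ℝ, EQ) (fun p => t.σ (B.proj p)) (S.incl q)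
      (tderiv 𝓘(ℝ, EQ) 𝓘(ℝ, EP) S.incl q w) =
      tderiv 𝓘(ℝ, EQ) 𝓘(ℝ, EQ) (fun q => t.σ (S.proj q)) q w := by
    rw [← tderiv_comp (t.mdifferentiableAt_σ_proj hp) (S.mdifferentiableAt_incl q) rfl]
    simp only [S.proj_incl]
  have e2 : tderiv 𝓘(ℝ, EP) 𝓘(ℝ, EH) t.α (S.incl q) (tderiv 𝓘(ℝ, EQ) 𝓘(ℝ, EP) S.incl q w) =
      tderiv 𝓘(ℝ, EG) 𝓘(ℝ, EH) ι.toHom (t.γ q) (tderiv 𝓘(ℝ, EQ) 𝓘(ℝ, EG) t.γ q w) := by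
    rw [← tderiv_comp (t.mdifferentiableAt_α hp) (S.mdifferentiableAt_incl q) rfl,
      ← tderiv_comp (ι.mdifferentiableAt _) hγ rfl]
    refine DFunLike.congr_fun (tderiv_congr ?_) w
    filter_upwards [hU] with q hq
    exact t.α_incl q hq
  have e3 := (A.isConnectionOver (S.proj q)).apply_act hσ hγ (t.proj_σ _ hq) w
  have e4 : tderiv 𝓘(ℝ, EQ) 𝓘(ℝ, EQ) (fun q => S.act (t.σ (S.proj q)) (t.γ q)) q w = w := by
    rw [tderiv_congr (g := fun q => q) (by filter_upwards [hU] with q hq using t.act_γ q hq)]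
    exact tderiv_id q w
  rw [e4, t.act_γ q hq] at e3
  rw [extForm_apply, e1, e2, t.α_incl q hq, S.proj_incl, e3, map_add, ι.lieE_adE,
    ι.lieE_maurerCartan, map_inv]

/-- The fundamental formula applied to p = σ(π(p)) α(p). Only conditions on the fibre through p
enter, so this gives both global uniqueness and the comparison of two local extensions. -/
theorem eq_extForm {η : P → EP →L[ℝ] EH} {p : P} (hp : B.proj p ∈ t.U)
    (hη : B.IsConnectionOver η (B.proj p))
    (hA : ∀ q, S.proj q = B.proj p → ∀ w,
      η (S.incl q) (tderiv 𝓘(ℝ, EQ) 𝓘(ℝ, EP) S.incl q w) = ι.lieE (A.formE q w)) :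
    η p = t.extForm A p := by
  refine ContinuousLinearMap.ext fun v => ?_
  have hσ := t.mdifferentiableAt_σ_proj hp
  have e1 := hη.apply_act (q := fun p => S.incl (t.σ (B.proj p))) (a := t.α)
    (MDifferentiableAt.comp p (S.mdifferentiableAt_incl _) hσ) (t.mdifferentiableAt_α hp)
    (by rw [S.proj_incl, t.proj_σ _ hp]) v
  have e2 : tderiv 𝓘(ℝ, EP) 𝓘(ℝ, EP)
      (fun p => B.act (S.incl (t.σ (B.proj p))) (t.α p)) p v = v := by
    rw [tderiv_congr (g := fun p => p) (by
      filter_upwards [t.isOpen_preimage.mem_nhds hp] with p hp using t.act_α p hp)]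
    exact tderiv_id p v
  rw [e2, t.act_α p hp, tderiv_comp (S.mdifferentiableAt_incl _) hσ rfl,
    hA _ (t.proj_σ _ hp)] at e1
  rw [e1, extForm_apply]

theorem contMDiffAt_extForm {v : TangentBundle 𝓘(ℝ, EP) P} (hv : B.proj v.proj ∈ t.U) :
    ContMDiffAt 𝓘(ℝ, EP).tangent 𝓘(ℝ, EH) ∞
      (fun v : TangentBundle 𝓘(ℝ, EP) P => t.extForm A v.proj (show EP from v.snd)) v := by
  have : IsManifold 𝓘(ℝ, EP) 1 P := .of_le (n := ∞) (by simp)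
  have : IsManifold 𝓘(ℝ, EQ) 1 Q := .of_le (n := ∞) (by simp)
  have : IsManifold 𝓘(ℝ, EH) 1 H := .of_le (n := ∞) (by simp)
  have h1 := A.contMDiff_formE.contMDiffAt.comp v
    (t.contMDiffOn_σ_proj.contMDiffAt_tangentMap t.isOpen_preimage hv)
  have h2 : ContMDiffAt 𝓘(ℝ, EP).tangent 𝓘(ℝ, EH) ∞
      (fun v : TangentBundle 𝓘(ℝ, EP) P => t.α v.proj) v :=
    ContMDiffAt.comp v (t.contMDiffOn_α.contMDiffAt (t.isOpen_preimage.mem_nhds hv))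
      (contMDiff_proj (TangentSpace 𝓘(ℝ, EP) : P → Type _)).contMDiffAt
  have h3 := contMDiff_adE.contMDiffAt.comp v h2.inv
  have h4 := contMDiff_maurerCartan.contMDiffAt.comp v
    (t.contMDiffOn_α.contMDiffAt_tangentMap t.isOpen_preimage hv)
  exact (h3.clm_apply (ι.lieE.contDiff.contMDiff.contMDiffAt.comp v h1)).add h4

end LocalTriv

/-- The extension of a connection on a subbundle to the ambient bundle. -/
def extend (S : PrincipalSubbundle B ι EQ Q) (A : S.Connection) : B.Connection :=
  -- The trivialisation is chosen anew at every point; uniqueness shows that the value does not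
  -- depend on it, which restores smoothness and equivariance.
  have key : ∀ (t : S.LocalTriv) (p : P), B.proj p ∈ t.U →
      (S.exists_localTriv (B.proj p)).choose.extForm A p = t.extForm A p := fun t p hp =>
    t.eq_extForm A hp (LocalTriv.isConnectionOver_extForm _ A
      (S.exists_localTriv (B.proj p)).choose_spec) fun q hq =>
        LocalTriv.extForm_incl _ A (by
          rw [S.proj_incl, hq]
          exact (S.exists_localTriv (B.proj p)).choose_spec)
  .ofFormE (fun p => (S.exists_localTriv (B.proj p)).choose.extForm A p)
    (fun v => by
      obtain ⟨t, ht⟩ := S.exists_localTriv (B.proj v.proj)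
      refine (t.contMDiffAt_extForm A ht).congr_of_eventuallyEq ?_
      have : (fun w : TangentBundle 𝓘(ℝ, EP) P => w.proj) ⁻¹' (B.proj ⁻¹' t.U) ∈ 𝓝 v :=
        (t.isOpen_preimage.preimage (FiberBundle.continuous_proj EP
          (TangentSpace 𝓘(ℝ, EP) : P → Type _))).mem_nhds ht
      filter_upwards [this] with w hw
      rw [key t _ hw])
    fun x => by
      obtain ⟨t, ht⟩ := S.exists_localTriv x
      exact (t.isConnectionOver_extForm A ht).congr fun p hp => key t p (by rwa [hp])

theorem isExtension_iff (S : PrincipalSubbundle B ι EQ Q) (A : S.Connection) (A' : B.Connection) :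
    S.IsExtension A A' ↔ ∀ q w,
      A'.formE (S.incl q) (tderiv 𝓘(ℝ, EQ) 𝓘(ℝ, EP) S.incl q w) = ι.lieE (A.formE q w) :=
  forall_congr' fun _ => ContinuousLinearMap.ext_iff

theorem isExtension_iff_eq_extend (S : PrincipalSubbundle B ι EQ Q) (A : S.Connection)
    (A' : B.Connection) : S.IsExtension A A' ↔ A' = S.extend A := by
  rw [isExtension_iff]
  constructor
  · intro h
    refine PrincipalBundle.Connection.ext_formE fun p v => ?_
    rw [LocalTriv.eq_extForm (S.exists_localTriv (B.proj p)).choose A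
      (S.exists_localTriv (B.proj p)).choose_spec (A'.isConnectionOver _) fun q _ w => h q w]
    rfl
  · rintro rfl q w
    exact LocalTriv.extForm_incl _ A (S.exists_localTriv (B.proj (S.incl q))).choose_spec w

theorem extend_incl (S : PrincipalSubbundle B ι EQ Q) (A : S.Connection) (q : Q) (w : EQ) :
    (S.extend A).formE (S.incl q) (tderiv 𝓘(ℝ, EQ) 𝓘(ℝ, EP) S.incl q w) =
      ι.lieE (A.formE q w) :=
  (S.isExtension_iff A _).1 ((S.isExtension_iff_eq_extend A _).2 rfl) q w

end PrincipalSubbundle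

namespace PrincipalSubbundle

variable {EM : Type*} [NormedAddCommGroup EM] [NormedSpace ℝ EM] [FiniteDimensional ℝ EM]
    {EG : Type*} [NormedAddCommGroup EG] [NormedSpace ℝ EG] [FiniteDimensional ℝ EG]
    {EH : Type*} [NormedAddCommGroup EH] [NormedSpace ℝ EH] [FiniteDimensional ℝ EH]
    {EP : Type*} [NormedAddCommGroup EP] [NormedSpace ℝ EP]
    {M : Type*} [TopologicalSpace M] [ChartedSpace EM M]
    {G : Type*} [TopologicalSpace G] [ChartedSpace EG G] [Group G] [LieGroup 𝓘(ℝ, EG) ∞ G]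
    [SecondCountableTopology G]
    {H : Type*} [TopologicalSpace H] [ChartedSpace EH H] [Group H] [LieGroup 𝓘(ℝ, EH) ∞ H]
    {P : Type*} [TopologicalSpace P] [ChartedSpace EP P] [IsManifold 𝓘(ℝ, EP) ∞ P]
    {B : PrincipalBundle EM EH EP M H P} {ι : LieSubgroupInclusion EG EH G H}
    {EQ : Type*} [NormedAddCommGroup EQ] [NormedSpace ℝ EQ]
    {Q : Type*} [TopologicalSpace Q] [ChartedSpace EQ Q] [IsManifold 𝓘(ℝ, EQ) ∞ Q]
    {𝔪 : Submodule ℝ (GroupLieAlgebra 𝓘(ℝ, EH) H)} {h : M → H}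

/-! ### Restriction to Q followed by projection along Ad(h)𝔪. -/

section Projection

variable (S : PrincipalSubbundle B ι EQ Q) (hm : IsInvariantSplitting ι 𝔪)

/-- The projection `𝔥 → 𝔤` along `Ad(a) 𝔪`, for `a` in the normaliser of `G`. -/
def _root_.IsInvariantSplitting.prConj (a : H) : EH →L[ℝ] EG :=
  hm.prE.toContinuousLinearMap.comp ((adE a).comp (ι.lieE.comp
    (hm.prE.toContinuousLinearMap.comp (adE a⁻¹))))

theorem _root_.IsInvariantSplitting.prConj_apply (a : H) (X : EH) :
    hm.prConj a X = hm.prE (adE a (ι.lieE (hm.prE (adE a⁻¹ X)))) := rfl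

theorem _root_.IsInvariantSplitting.prConj_one (X : EH) : hm.prConj 1 X = hm.prE X := by
  rw [hm.prConj_apply, inv_one, adE_one, adE_one, hm.prE_lieE]

theorem _root_.IsInvariantSplitting.lieE_prConj {a : H}
    (ha : a ∈ Subgroup.normalizer (ι.toHom.range : Set H)) (X : EH) :
    ι.lieE (hm.prConj a X) = adE a (ι.lieE (hm.prE (adE a⁻¹ X))) :=
  hm.lieE_prE_of_mem (ι.adE_lieE_mem_range ha _)

theorem _root_.IsInvariantSplitting.prConj_lieE {a : H}
    (ha : a ∈ Subgroup.normalizer (ι.toHom.range : Set H)) (X : EG) :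
    hm.prConj a (ι.lieE X) = X := by
  rw [hm.prConj_apply, hm.lieE_prE_of_mem (ι.adE_lieE_mem_range (inv_mem ha) _), adE_adE_inv,
    hm.prE_lieE]

/-- Ad(a)𝔪 is again G-invariant: g is moved past a as ga = a(a⁻¹ga) with a⁻¹ga in G, where the
invariance of 𝔪 applies. -/
theorem _root_.IsInvariantSplitting.prConj_adE {a : H}
    (ha : a ∈ Subgroup.normalizer (ι.toHom.range : Set H)) (g : G) (X : EH) :
    hm.prConj a (adE (ι.toHom g) X) = adE g (hm.prConj a X) := by
  have h1 : a⁻¹ * ι.toHom g = ι.toHom (ι.conj a⁻¹ g) * a⁻¹ := by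
    rw [ι.toHom_conj (inv_mem ha)]
    group
  have h2 : a * ι.toHom (ι.conj a⁻¹ g) = ι.toHom g * a := by
    rw [ι.toHom_conj (inv_mem ha)]
    group
  rw [hm.prConj_apply, ← adE_mul, h1, adE_mul, hm.prE_adE, ι.lieE_adE, ← adE_mul, h2, adE_mul,
    hm.prE_adE, hm.prConj_apply]

/-- The connection on a subbundle obtained by restricting a connection on the ambient bundle and
projecting to `𝔤` along `Ad(h) 𝔪`. -/
def projConnection (hh : ContMDiff 𝓘(ℝ, EM) 𝓘(ℝ, EH) ∞ h)
    (hN : ∀ x, h x ∈ Subgroup.normalizer (ι.toHom.range : Set H)) (A : B.Connection) :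
    S.Connection :=
  .ofFormE (fun q => (hm.prConj (h (S.proj q))).comp ((A.formE (S.incl q)).comp
      (tderiv 𝓘(ℝ, EQ) 𝓘(ℝ, EP) S.incl q)))
    (by
      have : IsManifold 𝓘(ℝ, EP) 1 P := .of_le (n := ∞) (by simp)
      have : IsManifold 𝓘(ℝ, EQ) 1 Q := .of_le (n := ∞) (by simp)
      have h1 : ContMDiff 𝓘(ℝ, EQ).tangent 𝓘(ℝ, EH) ∞ _ :=
        A.contMDiff_formE.comp (S.contMDiff_incl.contMDiff_tangentMap le_rfl)
      have h2 : ContMDiff 𝓘(ℝ, EQ).tangent 𝓘(ℝ, EH) ∞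
          (fun v : TangentBundle 𝓘(ℝ, EQ) Q => h (S.proj v.proj)) :=
        hh.comp (S.toPrincipalBundle.contMDiff_proj.comp
          (contMDiff_proj (TangentSpace 𝓘(ℝ, EQ) : Q → Type _)))
      have h3 := contMDiff_adE.comp h2
      have h4 := contMDiff_adE.comp h2.inv
      have h5 := (ι.lieE.comp hm.prE.toContinuousLinearMap).contDiff (n := ∞) |>.contMDiff.comp
        (h4.clm_apply h1)
      exact hm.prE.toContinuousLinearMap.contDiff.contMDiff.comp (h3.clm_apply h5))
    (fun x =>
      { equivariant := fun q _ g w => by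
          have hR : MDifferentiableAt 𝓘(ℝ, EQ) 𝓘(ℝ, EQ) (fun q => S.act q g) q :=
            (S.toPrincipalBundle.contMDiff_act_right g).contMDiffAt.mdifferentiableAt (by simp)
          have hR' : MDifferentiableAt 𝓘(ℝ, EP) 𝓘(ℝ, EP)
              (fun p => B.act p (ι.toHom g)) (S.incl q) :=
            (B.contMDiff_act_right _).contMDiffAt.mdifferentiableAt (by simp)
          have e : tderiv 𝓘(ℝ, EQ) 𝓘(ℝ, EP) S.incl (S.act q g)
              (tderiv 𝓘(ℝ, EQ) 𝓘(ℝ, EQ) (fun q => S.act q g) q w) =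
              tderiv 𝓘(ℝ, EP) 𝓘(ℝ, EP) (fun p => B.act p (ι.toHom g)) (S.incl q)
                (tderiv 𝓘(ℝ, EQ) 𝓘(ℝ, EP) S.incl q w) := by
            rw [← tderiv_comp (S.mdifferentiableAt_incl _) hR rfl,
              ← tderiv_comp hR' (S.mdifferentiableAt_incl q) rfl]
            simp only [S.incl_act]
          simp only [ContinuousLinearMap.comp_apply]
          rw [e, S.incl_act, S.proj_act, (A.isConnectionOver _).equivariant _ rfl, ← map_inv,
            hm.prConj_adE (hN _)]
        fundamental := fun q _ X => by
          have hL : MDifferentiableAt 𝓘(ℝ, EG) 𝓘(ℝ, EQ) (fun g => S.act q g) 1 :=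
            (S.toPrincipalBundle.contMDiff_act_left q).contMDiffAt.mdifferentiableAt (by simp)
          have hL' : MDifferentiableAt 𝓘(ℝ, EH) 𝓘(ℝ, EP) (fun a => B.act (S.incl q) a) 1 :=
            (B.contMDiff_act_left _).contMDiffAt.mdifferentiableAt (by simp)
          have e : tderiv 𝓘(ℝ, EQ) 𝓘(ℝ, EP) S.incl q
              (tderiv 𝓘(ℝ, EG) 𝓘(ℝ, EQ) (fun g => S.act q g) 1 X) =
              tderiv 𝓘(ℝ, EH) 𝓘(ℝ, EP) (fun a => B.act (S.incl q) a) 1 (ι.lieE X) := by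
            rw [LieSubgroupInclusion.lieE,
              ← tderiv_comp (S.mdifferentiableAt_incl _) hL (S.act_one q),
              ← tderiv_comp hL' (ι.mdifferentiableAt 1) (map_one _)]
            simp only [S.incl_act]
          simp only [ContinuousLinearMap.comp_apply]
          rw [e, (A.isConnectionOver _).fundamental _ rfl, hm.prConj_lieE (hN _)] })

theorem projConnection_formE (hh : ContMDiff 𝓘(ℝ, EM) 𝓘(ℝ, EH) ∞ h)
    (hN : ∀ x, h x ∈ Subgroup.normalizer (ι.toHom.range : Set H)) (A : B.Connection) (q : Q)
    (w : EQ) : (S.projConnection hm hh hN A).formE q w =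
      hm.prConj (h (S.proj q)) (A.formE (S.incl q) (tderiv 𝓘(ℝ, EQ) 𝓘(ℝ, EP) S.incl q w)) := rfl

end Projection

/-! ### The deformed subbundle Q'. -/

section Deform

variable (S : PrincipalSubbundle B ι EQ Q)

theorem _root_.PrincipalBundle.contMDiff_deform (hh : ContMDiff 𝓘(ℝ, EM) 𝓘(ℝ, EH) ∞ h) :
    ContMDiff 𝓘(ℝ, EP) 𝓘(ℝ, EP) ∞ (B.deform h) :=
  B.contMDiff_act.comp (contMDiff_id.prodMk (hh.comp B.contMDiff_proj))

/-- Fibrewise conjugation `(x, g) ↦ (x, h(x)⁻¹ g h(x))` as a homeomorphism of `M × G`. -/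
def conjHomeomorph (ι : LieSubgroupInclusion EG EH G H) (hh : ContMDiff 𝓘(ℝ, EM) 𝓘(ℝ, EH) ∞ h)
    (hN : ∀ x, h x ∈ Subgroup.normalizer (ι.toHom.range : Set H)) : M × G ≃ₜ M × G where
  toFun x := (x.1, ι.conj (h x.1)⁻¹ x.2)
  invFun x := (x.1, ι.conj (h x.1) x.2)
  left_inv x := by simp only [ι.conj_conj_inv (hN _)]
  right_inv x := by simp only [ι.conj_inv_conj (hN _)]
  continuous_toFun := continuous_fst.prodMk (ι.contMDiff_conj_comp
    (I := 𝓘(ℝ, EM).prod 𝓘(ℝ, EG)) (hh.comp contMDiff_fst).inv contMDiff_snd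
      fun x => inv_mem (hN _)).continuous
  continuous_invFun := continuous_fst.prodMk (ι.contMDiff_conj_comp
    (I := 𝓘(ℝ, EM).prod 𝓘(ℝ, EG)) (hh.comp contMDiff_fst) contMDiff_snd
      fun x => hN _).continuous

/-- A local trivialisation of `Q`, conjugated fibrewise by `h⁻¹`. -/
def conjTrivialization (hh : ContMDiff 𝓘(ℝ, EM) 𝓘(ℝ, EH) ∞ h)
    (hN : ∀ x, h x ∈ Subgroup.normalizer (ι.toHom.range : Set H))
    (e : Trivialization G S.proj) : Trivialization G S.proj where
  toOpenPartialHomeomorph := e.toOpenPartialHomeomorph.transHomeomorph (conjHomeomorph ι hh hN)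
  baseSet := e.baseSet
  open_baseSet := e.open_baseSet
  source_eq := e.source_eq
  target_eq := by
    refine Set.ext fun x => ?_
    change (conjHomeomorph ι hh hN).symm x ∈ e.target ↔ _
    rw [e.target_eq]
    simp [conjHomeomorph]
  proj_toFun p hp := e.proj_toFun p hp

/-- The image of a principal subbundle under the map `p ↦ R_{h(π(p))} p`, for `h` with values in the
normaliser of the structure group. -/
def deform (hh : ContMDiff 𝓘(ℝ, EM) 𝓘(ℝ, EH) ∞ h)
    (hN : ∀ x, h x ∈ Subgroup.normalizer (ι.toHom.range : Set H)) :
    PrincipalSubbundle B ι EQ Q where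
  proj := S.proj
  -- Forced by equivariance of the new inclusion: (q·hgh⁻¹)·h = (q·h)·g.
  act q g := S.act q (ι.conj (h (S.proj q)) g)
  act_one q := by rw [ι.conj_one (hN _), S.act_one]
  act_mul q a b := by rw [ι.conj_mul (hN _), S.act_mul, S.proj_act]
  contMDiff_act := by
    exact S.contMDiff_act.comp (contMDiff_fst.prodMk (ι.contMDiff_conj_comp
      (hh.comp (S.toPrincipalBundle.contMDiff_proj.comp contMDiff_fst)) contMDiff_snd
      fun _ => hN _))
  proj_act q a := S.proj_act q _
  locallyTrivial x := by
    obtain ⟨e, he, hs, hs', hact⟩ := S.locallyTrivial x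
    have hc : ContMDiff (𝓘(ℝ, EM).prod 𝓘(ℝ, EG)) (𝓘(ℝ, EM).prod 𝓘(ℝ, EG)) ∞
        (conjHomeomorph ι hh hN) :=
      contMDiff_fst.prodMk (ι.contMDiff_conj_comp (hh.comp contMDiff_fst).inv contMDiff_snd
        fun _ => inv_mem (hN _))
    have hc' : ContMDiff (𝓘(ℝ, EM).prod 𝓘(ℝ, EG)) (𝓘(ℝ, EM).prod 𝓘(ℝ, EG)) ∞
        (conjHomeomorph ι hh hN).symm :=
      contMDiff_fst.prodMk (ι.contMDiff_conj_comp (hh.comp contMDiff_fst) contMDiff_snd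
        fun _ => hN _)
    refine ⟨S.conjTrivialization hh hN e, he, hc.comp_contMDiffOn hs,
      hs'.comp hc'.contMDiffOn fun _ hx => hx, fun q hq a => ?_⟩
    have hq' : (e q).1 = S.proj q := e.coe_fst hq
    change ((e (S.act q (ι.conj (h (S.proj q)) a))).1,
      ι.conj (h (e (S.act q (ι.conj (h (S.proj q)) a))).1)⁻¹
        (e (S.act q (ι.conj (h (S.proj q)) a))).2) = ((e q).1, ι.conj (h (e q).1)⁻¹ (e q).2 * a)
    rw [hact q hq]
    simp only [hq', ι.conj_mul (inv_mem (hN _)), ι.conj_inv_conj (hN _)]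
  incl q := B.act (S.incl q) (h (S.proj q))
  contMDiff_incl := B.contMDiff_act.comp
    (S.contMDiff_incl.prodMk (hh.comp S.toPrincipalBundle.contMDiff_proj))
  injective_incl q q' hqq := by
    have hp : S.proj q = S.proj q' := by
      have := congrArg B.proj hqq
      simpa only [B.proj_act, S.proj_incl] using this
    have := congrArg (fun p => B.act p (h (S.proj q'))⁻¹) hqq
    simp only [hp, B.act_act_inv] at this
    exact S.injective_incl this
  immersive_incl q := by
    -- Composing with the deformation by h⁻¹ gives back the inclusion of Q, so the new differential
    -- is injective because the old one is.
    have hd : MDifferentiableAt 𝓘(ℝ, EP) 𝓘(ℝ, EP) (B.deform fun x => (h x)⁻¹)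
        (B.act (S.incl q) (h (S.proj q))) :=
      (B.contMDiff_deform hh.inv).contMDiffAt.mdifferentiableAt (by simp)
    have hi : MDifferentiableAt 𝓘(ℝ, EQ) 𝓘(ℝ, EP)
        (fun q => B.act (S.incl q) (h (S.proj q))) q :=
      (B.contMDiff_act.comp (S.contMDiff_incl.prodMk
        (hh.comp S.toPrincipalBundle.contMDiff_proj))).contMDiffAt.mdifferentiableAt (by simp)
    have key : ∀ w : EQ, tderiv 𝓘(ℝ, EP) 𝓘(ℝ, EP) (B.deform fun x => (h x)⁻¹)
        (B.act (S.incl q) (h (S.proj q)))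
        (tderiv 𝓘(ℝ, EQ) 𝓘(ℝ, EP) (fun q => B.act (S.incl q) (h (S.proj q))) q w) =
        tderiv 𝓘(ℝ, EQ) 𝓘(ℝ, EP) S.incl q w := by
      intro w
      rw [← tderiv_comp hd hi rfl]
      simp only [PrincipalBundle.deform, B.proj_act, S.proj_incl, B.act_act_inv]
    exact fun v w hvw => S.immersive_incl q (((key v).symm.trans (congrArg _ hvw)).trans (key w))
  proj_incl q := by rw [B.proj_act, S.proj_incl]
  incl_act q g := by
    rw [S.incl_act, S.proj_act, ι.toHom_conj (hN _), ← B.act_mul, ← B.act_mul,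
      inv_mul_cancel_right]

variable (hh : ContMDiff 𝓘(ℝ, EM) 𝓘(ℝ, EH) ∞ h)
  (hN : ∀ x, h x ∈ Subgroup.normalizer (ι.toHom.range : Set H))

theorem deform_incl (q : Q) : (S.deform hh hN).incl q = B.deform h (S.incl q) := by
  rw [PrincipalBundle.deform, S.proj_incl]
  rfl

/-- The restriction of a connection to the deformed subbundle, in terms of its restriction to the
original one. -/
theorem formE_deform_incl (A : B.Connection) (q : Q) (w : EQ) :
    A.formE ((S.deform hh hN).incl q)
        (tderiv 𝓘(ℝ, EQ) 𝓘(ℝ, EP) (S.deform hh hN).incl q w) =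
      adE (h (S.proj q))⁻¹ (A.formE (S.incl q) (tderiv 𝓘(ℝ, EQ) 𝓘(ℝ, EP) S.incl q w)) +
        maurerCartan (h (S.proj q)) (tderiv 𝓘(ℝ, EQ) 𝓘(ℝ, EH) (fun q => h (S.proj q)) q w) :=
  (A.isConnectionOver (S.proj q)).apply_act (S.mdifferentiableAt_incl q)
    ((hh.comp S.toPrincipalBundle.contMDiff_proj).contMDiffAt.mdifferentiableAt (by simp))
    (S.proj_incl q) w

end Deform

/-! ### Bijectivity of the composite map. -/

section Main

variable (S : PrincipalSubbundle B ι EQ Q) (hm : IsInvariantSplitting ι 𝔪)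

/-- Restriction of a connection to the subbundle, followed by the projection to `𝔤` along `𝔪`. -/
def restrictConnection (A : B.Connection) : S.Connection :=
  -- For h = 1 the twisted projection is the projection along 𝔪 itself.
  S.projConnection hm (h := fun _ => 1) contMDiff_const (fun _ => one_mem _) A

theorem restrictConnection_formE (A : B.Connection) (q : Q) (w : EQ) :
    (S.restrictConnection hm A).formE q w =
      hm.prE (A.formE (S.incl q) (tderiv 𝓘(ℝ, EQ) 𝓘(ℝ, EP) S.incl q w)) := by
  rw [restrictConnection, projConnection_formE, hm.prConj_one]

variable (hh : ContMDiff 𝓘(ℝ, EM) 𝓘(ℝ, EH) ∞ h)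
  (hN : ∀ x, h x ∈ Subgroup.normalizer (ι.toHom.range : Set H))

theorem restrictConnection_deform_extend_formE (A : S.Connection) (q : Q) (w : EQ) :
    ((S.deform hh hN).restrictConnection hm (S.extend A)).formE q w =
      hm.prE (adE (h (S.proj q))⁻¹ (ι.lieE (A.formE q w))) +
        hm.prE (maurerCartan (h (S.proj q))
          (tderiv 𝓘(ℝ, EQ) 𝓘(ℝ, EH) (fun q => h (S.proj q)) q w)) := by
  rw [restrictConnection_formE, formE_deform_incl, extend_incl, map_add]

/-- The Maurer–Cartan terms cancel, and pr loses nothing on Ad(h⁻¹)𝔤 ⊂ 𝔤. -/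
theorem injective_restrict_extend : Function.Injective fun A : S.Connection =>
    (S.deform hh hN).restrictConnection hm (S.extend A) := by
  intro A A' hA
  refine PrincipalBundle.Connection.ext_formE fun q w => ?_
  have e := congrArg (fun A => PrincipalBundle.Connection.formE A q w) hA
  dsimp only at e
  rw [restrictConnection_deform_extend_formE, restrictConnection_deform_extend_formE,
    add_left_inj] at e
  have e' := congrArg ι.lieE e
  rw [hm.lieE_prE_of_mem (ι.adE_lieE_mem_range (inv_mem (hN _)) _),
    hm.lieE_prE_of_mem (ι.adE_lieE_mem_range (inv_mem (hN _)) _)] at e'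
  have e'' := congrArg (adE (h (S.proj q))) e'
  rw [adE_adE_inv, adE_adE_inv] at e''
  exact ι.lieE_injective e''

theorem surjective_restrict_extend : Function.Surjective fun A : S.Connection =>
    (S.deform hh hN).restrictConnection hm (S.extend A) := by
  intro A'
  -- If X is the restriction to Q of the extension of A', the preimage is Ad(h) pr(Ad(h⁻¹)X). Its
  -- image is pr(Ad(h⁻¹)X + h⁻¹dh), the projection of that extension restricted to Q', which is A'.
  refine ⟨S.projConnection hm hh hN ((S.deform hh hN).extend A'),
    PrincipalBundle.Connection.ext_formE fun q w => ?_⟩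
  dsimp only
  rw [restrictConnection_deform_extend_formE, projConnection_formE, hm.lieE_prConj (hN _),
    adE_inv_adE, hm.prE_lieE, ← map_add, ← S.formE_deform_incl hh hN, extend_incl, hm.prE_lieE]

end Main

end PrincipalSubbundle

end

theorem theorem3p3
    {EM : Type*} [NormedAddCommGroup EM] [NormedSpace ℝ EM] [FiniteDimensional ℝ EM]
    {EG : Type*} [NormedAddCommGroup EG] [NormedSpace ℝ EG] [FiniteDimensional ℝ EG]
    {EH : Type*} [NormedAddCommGroup EH] [NormedSpace ℝ EH] [FiniteDimensional ℝ EH]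
    {EP : Type*} [NormedAddCommGroup EP] [NormedSpace ℝ EP] [FiniteDimensional ℝ EP]
    {EQ : Type*} [NormedAddCommGroup EQ] [NormedSpace ℝ EQ] [FiniteDimensional ℝ EQ]
    {M : Type*} [TopologicalSpace M] [ChartedSpace EM M] [IsManifold 𝓘(ℝ, EM) ∞ M]
    {G : Type*} [TopologicalSpace G] [ChartedSpace EG G] [Group G] [LieGroup 𝓘(ℝ, EG) ∞ G]
    [SecondCountableTopology G]
    {H : Type*} [TopologicalSpace H] [ChartedSpace EH H] [Group H] [LieGroup 𝓘(ℝ, EH) ∞ H]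
    {P : Type*} [TopologicalSpace P] [ChartedSpace EP P] [IsManifold 𝓘(ℝ, EP) ∞ P]
    {Q : Type*} [TopologicalSpace Q] [ChartedSpace EQ Q] [IsManifold 𝓘(ℝ, EQ) ∞ Q]
    (B : PrincipalBundle EM EH EP M H P)
    (ι : LieSubgroupInclusion EG EH G H)
    (S : PrincipalSubbundle B ι EQ Q)
    (𝔪 : Submodule ℝ (GroupLieAlgebra 𝓘(ℝ, EH) H)) (hm : IsInvariantSplitting ι 𝔪)
    (h : M → H) (hh : ContMDiff 𝓘(ℝ, EM) 𝓘(ℝ, EH) ∞ h)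
    (hN : ∀ x, h x ∈ Subgroup.normalizer (ι.toHom.range : Set H)) :
    -- the image of the submanifold under `p ↦ R_{h(π(p))} p` is a principal `G`-subbundle `S'`
    ∃ S' : PrincipalSubbundle B ι EQ Q, (∀ q, S'.incl q = B.deform h (S.incl q)) ∧
      -- `fhat A` is the unique extension of `A` to a connection on `P`,
      -- `fcheck A` is the projection to `𝔤` of the restriction of `A` to `S'`
      ∃ (fhat : S.Connection → B.Connection) (fcheck : B.Connection → S'.Connection),
        (∀ (A : S.Connection) (A' : B.Connection), S.IsExtension A A' ↔ A' = fhat A) ∧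
        (∀ (A : B.Connection) (q : Q) (v : TangentSpace 𝓘(ℝ, EQ) q),
          (fcheck A).form q v = hm.pr (S'.restrictForm A q v)) ∧
        Function.Bijective (fcheck ∘ fhat) := by

  refine ⟨S.deform hh hN, S.deform_incl hh hN, S.extend,
    (S.deform hh hN).restrictConnection hm, S.isExtension_iff_eq_extend,
    fun A q v => (S.deform hh hN).restrictConnection_formE hm A q v,
    S.injective_restrict_extend hm hh hN, S.surjective_restrict_extend hm hh hN⟩
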